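/- Fix an integer $k\ge 1$; $\log$ is to base 2. A $k$-substring edit $x\to y$ of a binary string $x$ replaces a (possibly empty) substring $u$ of $x$ by a string $v$, where $|u|,|v|\le k$. A set $D$ of binary strings corrects one $k$-substring edit if $x,x'\in D$, $x\to y$ and $x'\to y$ imply $x=x'$; the redundancy of a code $D\subseteq\{0,1\}^n$ is $n-\log|D|$. Cut a binary string $x$ immediately before each occurrence of the pattern $0^k1^k$, which gives the parts $x_1,\dots,x_{n_{\mathcal P}(x)}$ ($x_1$ starts at the first bit of $x$ and is empty if $x$ starts with the pattern). For real $\delta$, $x$ is $(\mathcal P,\delta)$-dense if all its parts have length at most $\delta$. Let $B=3\cdot 2^k$, $C=40k2^k$, and $f(u)=d(u)+B\,n_{1^k}(u)+C|u|$ for a binary string $u$, where $n_{1^k}(u)$ is the number of (possibly overlapping) occurrences of $1^k$ in $u$, and $d(u)\in[0,2^k-1]$ has as its $j$-th binary digit (most significant first, $1\le j\le k$) the parity of $\sum_{i\equiv j \bmod k}u_i$. For $x\in\{0,1\}^n$ let $$h(x)=\Big(\sum_{i} i\,f(x_i)\bmod 2000Cn,\ \ \sum_{i} f(x_i)\bmod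 10Ck,\ \ n_{\mathcal P}(x)\bmod 5\Big),$$ the sums running over $1\le i\le n_{\mathcal P}(x)$. Let $\phi_A:\{0,1\}^A\to\{0,1\}^{m(A)}$, $A\in\mathbb N$, be hashes with $m(A)\le 4k\log A+o(\log A)$ that correct one $k$-substring edit: if $r,r'\in\{0,1\}^A$, $r\to s$, $r'\to s$ and $\phi_A(r)=\phi_A(r')$, then $r=r'$. Cut $x$ into consecutive blocks of length $A$ (the last one padded by zeros), and let $\psi_A(x)$ be the pair consisting of the sum of the hash values (read as integers) of the odd-numbered blocks and that of the even-numbered blocks, both modulo $2^{m(A)}$. For values $c_1,c_2$ let $$\mathcal C=\{x\in\{0,1\}^n:\ x\text{ is }(\mathcal P,\delta)\text{-dense},\ h(x)=c_1,\ \psi_A(x)=c_2\}.$$ **Theorem.** Such hashes $\phi_A$ exist, and there is a constant $K_0>0$ depending only on $k$ such that, for every such family $(\phi_A)$: 1. For all $n$, $\delta$, $c_1$, $c_2$ and all $A\ge K_0\delta^2$, the code $\mathcal C$ corrects one $k$-substring edit. 2. Let $\delta=\delta_n=k2^{2k+3}\log n$, and let $A=A_n\ge K_0\delta_n^2$ for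 all $n$, with $A_n=O(\delta_n^2)$. Then for each $n$ there are values $c_1,c_2$ for which, as $n\to\infty$, $\mathcal C$ has redundancy $\log n+O(\log\log n)$. This is asymptotically optimal: if $\rho_n$ is the smallest redundancy of a nonempty code in $\{0,1\}^n$ that corrects one $k$-substring edit, then the redundancy of $\mathcal C$ exceeds $\rho_n$ by at most $O(\log\log n)$, and their ratio tends to $1$. -/

import Mathlib

open Filter Asymptotics

namespace EditCode

/-- `SubstringEdit k x y`: the string `y` arises from `x` by one `k`-substring edit, i.e. by replacing
a (possibly empty) substring `u` of length at most `k` by a string `v` of length at most `k`. -/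
def SubstringEdit (k : ℕ) (x y : List Bool) : Prop :=
  ∃ a u v b : List Bool,
    u.length ≤ k ∧ v.length ≤ k ∧ x = a ++ u ++ b ∧ y = a ++ v ++ b

/-- A code (a set of binary strings) corrects one `k`-substring edit if every received string
arises from at most one codeword. -/
def Corrects (k : ℕ) (D : Set (List Bool)) : Prop :=
  ∀ x ∈ D, ∀ x' ∈ D, ∀ y, SubstringEdit k x y → SubstringEdit k x' y → x = x'

/-- The pattern `0^k 1^k`. -/
def pattern (k : ℕ) : List Bool :=
  List.replicate k false ++ List.replicate k true

/-- The parts `x_1, x_2, …` of `x`: the string is cut immediately before every occurrence of the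
pattern. The first part starts at the beginning of `x`; it is empty if `x` starts with the
pattern (or is empty). The fallback `[]` in the first case is never reached. -/
def parts (k : ℕ) : List Bool → List (List Bool)
  | [] => [[]]
  | c :: t =>
    match parts k t with
    | [] => []
    | q :: qs =>
      if pattern k <+: c :: t then [] :: (c :: q) :: qs else (c :: q) :: qs

/-- `x` is dense with parameter `δ`: all its parts have length at most `δ`. -/
def Dense (k : ℕ) (δ : ℝ) (x : List Bool) : Prop :=
  ∀ q ∈ parts k x, (q.length : ℝ) ≤ δ

/-- The `k` parities of the bits of `x` along the residue classes of the positions modulo `k`, read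
as a binary number whose most significant bit belongs to the class of the first position. -/
def d (k : ℕ) (x : List Bool) : ℕ :=
  ∑ j ∈ Finset.range k,
    ((∑ i ∈ Finset.range x.length with i % k = j, (x.getD i false).toNat) % 2) * 2 ^ (k - 1 - j)

/-- The number of (possibly overlapping) occurrences of `1^k` in `x`. -/
def numOnes (k : ℕ) (x : List Bool) : ℕ :=
  ((Finset.range x.length).filter (fun i => List.replicate k true <+: x.drop i)).card

/-- The constant `B = 3 · 2^k`. -/
def B (k : ℕ) : ℕ := 3 * 2 ^ k

/-- The constant `C = 40 k 2^k`. -/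
def C (k : ℕ) : ℕ := 40 * k * 2 ^ k

/-- `f(x) = d(x) + B n_{1^k}(x) + C |x|`. -/
def f (k : ℕ) (x : List Bool) : ℕ :=
  d k x + B k * numOnes k x + C k * x.length

/-- The integer string obtained by applying `f` to every part of `x`. -/
def fString (k : ℕ) (x : List Bool) : List ℕ :=
  (parts k x).map (f k)

/-- The VT sketch `∑ i z_i` (positions counted from `1`). -/
def VT (z : List ℕ) : ℕ :=
  ∑ i ∈ Finset.range z.length, (i + 1) * z.getD i 0

/-- The hash `h` for strings of length `n`. -/
def h (k n : ℕ) (x : List Bool) : ℕ × ℕ × ℕ :=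
  (VT (fString k x) % (2000 * C k * n),
    (fString k x).sum % (10 * C k * k),
    (parts k x).length % 5)

/-- `φ` is a family of hashes `φ_A : {0,1}^A → {0,1}^{m A}` that correct a single `k`-substring edit
(`r` is determined by `φ_A r` and any `s` arising from `r` by an edit), with
`m A ≤ 4 k log A + o(log A)`. Hash values are bit strings read as integers in `[0, 2^{m A})`;
only the values of `φ A` on strings of length `A` matter. -/
structure IsEditHash (k : ℕ) (m : ℕ → ℕ) (φ : ℕ → List Bool → ℕ) : Prop where
  lt_two_pow : ∀ (A : ℕ) (r : List Bool), r.length = A → φ A r < 2 ^ m A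
  corrects : ∀ (A : ℕ) (r r' s : List Bool), r.length = A → r'.length = A →
    SubstringEdit k r s → SubstringEdit k r' s → φ A r = φ A r' → r = r'
  size : ∃ e : ℕ → ℝ, (e =o[atTop] fun A : ℕ => Real.logb 2 (A : ℝ)) ∧
    ∀ A : ℕ, (m A : ℝ) ≤ 4 * k * Real.logb 2 (A : ℝ) + e A

/-- The `i`-th (counted from `0`) of the consecutive blocks of length `A` of `x`; the last block is
padded by zeros to length `A`. -/
def block (A : ℕ) (x : List Bool) (i : ℕ) : List Bool :=
  ((x.drop (i * A)).take A).rightpad A false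

/-- The number `⌈|x| / A⌉` of blocks of length `A`. -/
def numBlocks (A : ℕ) (x : List Bool) : ℕ :=
  (x.length + A - 1) / A

/-- The block hash `ψ_A`: the sums of the hashes of the blocks with odd number and of the blocks
with even number (numbers counted from `1`), both modulo `2^{m A}`. -/
def psi (m : ℕ → ℕ) (φ : ℕ → List Bool → ℕ) (A : ℕ) (x : List Bool) : ℕ × ℕ :=
  ((∑ i ∈ Finset.range (numBlocks A x) with Odd (i + 1), φ A (block A x i)) % 2 ^ m A,
    (∑ i ∈ Finset.range (numBlocks A x) with Even (i + 1), φ A (block A x i)) % 2 ^ m A)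

/-- The code of length `n`: the dense strings with prescribed values of `h` and `ψ_A`. -/
def code (k n : ℕ) (δ : ℝ) (m : ℕ → ℕ) (φ : ℕ → List Bool → ℕ) (A : ℕ)
    (c₁ : ℕ × ℕ × ℕ) (c₂ : ℕ × ℕ) : Set (List Bool) :=
  {x | x.length = n ∧ Dense k δ x ∧ h k n x = c₁ ∧ psi m φ A x = c₂}

/-- The redundancy `n - log₂ |D|` of a code `D` of length `n`. -/
noncomputable def redundancy (n : ℕ) (D : Set (List Bool)) : ℝ :=
  (n : ℝ) - Real.logb 2 (D.ncard : ℝ)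

/-- The smallest redundancy of a nonempty code of length `n` that corrects one `k`-substring
edit. -/
noncomputable def optRedundancy (k n : ℕ) : ℝ :=
  sInf {r : ℝ | ∃ D : Set (List Bool), D.Nonempty ∧ (∀ x ∈ D, x.length = n) ∧
    Corrects k D ∧ r = redundancy n D}

/-- The density parameter `δ = k 2^{2k+3} log₂ n`. -/
noncomputable def delta (k n : ℕ) : ℝ :=
  (k : ℝ) * 2 ^ (2 * k + 3) * Real.logb 2 (n : ℝ)

end EditCode

/-!
Suppose that two dense strings with the same hashes can be turned into the same string by one edit
each. An edit changes only a group of at most three consecutive parts. If the groups of the two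
edits are separated by many common parts, then the numbers of parts modulo `5` and the sums of the
values of `f` determine by how much each edit changes the number of parts and their total value of
`f`, and the difference of the two VT sketches is then an exact identity in which the separating
parts contribute more than the groups themselves, unless the first edit changes neither quantity.
In that case the edit is trivial: the three terms of `f` have different scales, so its lengths and
occurrences of `1^k` are unchanged. An occurrence of the pattern cannot move without changing the
number of occurrences of `1^k`, hence all parts keep their lengths, and the parities `d` exclude a
local substitution. So the strings agree outside a window of length `O(δ²)`. It meets at most two
neighbouring blocks of length `A`, and `ψ_A` recovers both of them.

Confusable strings form a graph of degree `O(A²)`, and colouring it greedily gives hashes of length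
`2 log A + O(1)`. For `δ = δ_n` at least half of all strings are dense, since a long part
consists of many windows of length `2k` that avoid the pattern. By the pigeonhole principle some
values of the hashes give redundancy at most `log n + O(1) + 2 m(A)`, where `m(A) = O(log log n)`.
A code that corrects one edit corrects one substitution, so its redundancy is at least
`log (n + 1)`.
-/

namespace EditCode

/-! ### Occurrences of a word -/

section Occurrences

variable {α : Type*} {w s t : List α}

lemma prefix_append_iff (hs : w.length ≤ s.length) : w <+: s ++ t ↔ w <+: s :=
  ⟨fun hw => List.prefix_of_prefix_length_le hw (List.prefix_append s t) hs,
    fun hw => hw.trans (List.prefix_append s t)⟩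

variable [DecidableEq α]

/-- The number of (possibly overlapping) occurrences of `w` in `x`. For nonempty `w`, restricting
the starting positions to those below `x.length` loses nothing. -/
def occ (w x : List α) : ℕ :=
  ((Finset.range x.length).filter fun i => w <+: x.drop i).card

/-- The number of occurrences of `w` in `s ++ t` that start in `s` and end in `t`. -/
def straddle (w s t : List α) : ℕ :=
  ((Finset.range s.length).filter fun i =>
    s.length < i + w.length ∧ w <+: (s ++ t).drop i).card

lemma occ_le_length (w x : List α) : occ w x ≤ x.length :=
  (Finset.card_filter_le _ _).trans_eq (Finset.card_range _)

lemma occ_eq_zero_of_length_lt {x : List α} (hx : x.length < w.length) : occ w x = 0 := by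
  refine Finset.card_eq_zero.2 (Finset.filter_eq_empty_iff.2 fun i _ hi => ?_)
  have := hi.length_le
  rw [List.length_drop] at this
  omega

lemma occ_append (w s t : List α) : occ w (s ++ t) = occ w s + occ w t + straddle w s t := by
  have starts_left : ∀ i ∈ Finset.range s.length,
      (if w <+: (s ++ t).drop i then 1 else 0) = (if w <+: s.drop i then 1 else 0) +
        if s.length < i + w.length ∧ w <+: (s ++ t).drop i then 1 else 0 := by
    intro i hi
    have hi : i ≤ s.length := (Finset.mem_range.1 hi).le
    rcases le_or_gt (i + w.length) s.length with hle | hlt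
    · have : w <+: (s ++ t).drop i ↔ w <+: s.drop i := by
        rw [List.drop_append_of_le_length hi,
          prefix_append_iff (by rw [List.length_drop]; omega)]
      simp [this, hle.not_gt]
    · have : ¬ w <+: s.drop i := fun hw => by
        have := hw.length_le
        rw [List.length_drop] at this
        omega
      simp [this, hlt]
  simp only [occ, straddle, Finset.card_filter, List.length_append]
  rw [Finset.sum_range_add, Finset.sum_congr rfl starts_left, Finset.sum_add_distrib]
  simp only [List.drop_append, List.drop_eq_nil_of_le (Nat.le_add_right _ _), List.nil_append,
    Nat.add_sub_cancel_left]
  exact add_right_comm _ _ _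

lemma occ_cons (w : List α) (c : α) (t : List α) :
    occ w (c :: t) = (if w <+: c :: t then 1 else 0) + occ w t := by
  simp only [occ, Finset.card_filter, List.length_cons, Finset.sum_range_succ',
    List.drop_succ_cons, List.drop_zero]
  exact add_comm _ _

lemma straddle_le_length_left (w s t : List α) : straddle w s t ≤ s.length :=
  (Finset.card_filter_le _ _).trans_eq (Finset.card_range _)

lemma straddle_le_length (w s t : List α) : straddle w s t ≤ w.length := by
  refine (Finset.card_le_card (t := Finset.Ico (s.length - w.length) s.length)
    fun i hi => ?_).trans ?_
  · simp only [Finset.mem_filter, Finset.mem_range, Finset.mem_Ico] at hi ⊢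
    omega
  · rw [Nat.card_Ico]
    omega

end Occurrences

/-! ### The patterns `0^k 1^k` and `1^k` in bit sequences -/

/-- The bits of `x` as a sequence, so that strings can be compared position by position;
positions beyond the end of `x` carry the bit `0`. -/
def bits (x : List Bool) (i : ℕ) : Bool := x.getD i false

/-- `1^k` occurs in the bit sequence `X` at position `i`. -/
def OnesAt (k : ℕ) (X : ℕ → Bool) (i : ℕ) : Prop :=
  ∀ e, i ≤ e → e < i + k → X e = true

/-- The pattern `0^k 1^k` occurs in the bit sequence `X` at position `i`. -/
def PatternAt (k : ℕ) (X : ℕ → Bool) (i : ℕ) : Prop :=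
  (∀ e, i ≤ e → e < i + k → X e = false) ∧ OnesAt k X (i + k)

section Pattern

variable {k : ℕ}

lemma length_pattern (k : ℕ) : (pattern k).length = 2 * k := by
  simp [pattern, two_mul]

lemma bits_append_left {s t : List Bool} {i : ℕ} (hi : i < s.length) :
    bits (s ++ t) i = bits s i :=
  List.getD_append _ _ _ _ hi

lemma bits_append_right {s t : List Bool} {i : ℕ} (hi : s.length ≤ i) :
    bits (s ++ t) i = bits t (i - s.length) :=
  List.getD_append_right _ _ _ _ hi

lemma lt_length_of_bits {x : List Bool} {i : ℕ} (hi : bits x i = true) : i < x.length := by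
  by_contra! hle
  rw [bits, List.getD_eq_default _ _ hle] at hi
  exact Bool.false_ne_true hi

lemma getElem?_eq_some_bits {x : List Bool} {i : ℕ} (hi : i < x.length) :
    x[i]? = some (bits x i) := by
  rw [bits, List.getD_eq_getElem _ _ hi, List.getElem?_eq_getElem hi]

lemma ones_prefix_drop_iff {x : List Bool} {i : ℕ} :
    List.replicate k true <+: x.drop i ↔ OnesAt k (bits x) i := by
  have bit_eq_true (e : ℕ) : x[e]? = some true ↔ bits x e = true := by
    cases hx : x[e]? <;> simp [bits, List.getD, hx]
  simp only [List.prefix_iff_getElem?, List.length_replicate, List.getElem_replicate,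
    List.getElem?_drop, bit_eq_true]
  refine ⟨fun hx e hie hek => ?_, fun hx j hj => hx _ (by omega) (by omega)⟩
  simpa [Nat.add_sub_cancel' hie] using hx (e - i) (by omega)

lemma pattern_prefix_drop_iff (hk : 1 ≤ k) {x : List Bool} {i : ℕ} :
    pattern k <+: x.drop i ↔ PatternAt k (bits x) i := by
  have prefix_iff : pattern k <+: x.drop i ↔
      ∀ j < 2 * k, x[i + j]? = some (decide (k ≤ j)) := by
    simp only [List.prefix_iff_getElem?, length_pattern, List.getElem?_drop]
    refine forall₂_congr fun j _ => ?_
    rcases lt_or_ge j k with hjk | hkj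
    · simp [pattern, hjk, hjk.not_ge]
    · simp [pattern, hkj]
  rw [prefix_iff]
  constructor
  · intro hx
    have bit (e : ℕ) (hie : i ≤ e) (hek : e < i + 2 * k) : bits x e = decide (k ≤ e - i) := by
      rw [bits, List.getD, ← Nat.add_sub_cancel' hie, hx (e - i) (by omega)]
      simp
    exact ⟨fun e hie hek => by rw [bit e hie (by omega)]; exact decide_eq_false (by omega),
      fun e hie hek => by rw [bit e (by omega) (by omega)]; exact decide_eq_true (by omega)⟩
  · rintro ⟨zeros, ones⟩ j hj
    have := lt_length_of_bits (ones (i + k + (k - 1)) (by omega) (by omega))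
    rw [getElem?_eq_some_bits (by omega), Option.some_inj]
    rcases lt_or_ge j k with hjk | hkj
    · rw [zeros (i + j) (by omega) (by omega), decide_eq_false hjk.not_ge]
    · rw [ones (i + j) (by omega) (by omega), decide_eq_true hkj]

lemma pattern_prefix_iff (hk : 1 ≤ k) {x : List Bool} :
    pattern k <+: x ↔ PatternAt k (bits x) 0 := by
  simpa using pattern_prefix_drop_iff hk (x := x) (i := 0)

lemma PatternAt.add_le_of_lt {X : ℕ → Bool} {i j : ℕ} (hi : PatternAt k X i)
    (hj : PatternAt k X j) (hij : i < j) : i + 2 * k ≤ j := by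
  by_contra! hlt
  -- the bit at position `max (i + k) j` is a one of the first and a zero of the second occurrence
  have one := hi.2 (max (i + k) j) (by omega) (by omega)
  have zero := hj.1 (max (i + k) j) (by omega) (by omega)
  simp [one] at zero

lemma straddle_pattern_le_one (hk : 1 ≤ k) (s t : List Bool) : straddle (pattern k) s t ≤ 1 := by
  refine Finset.card_le_one.2 fun i hi j hj => ?_
  simp only [Finset.mem_filter, Finset.mem_range, length_pattern, pattern_prefix_drop_iff hk]
    at hi hj
  rcases lt_trichotomy i j with hij | rfl | hji
  · have := hi.2.2.add_le_of_lt hj.2.2 hij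
    omega
  · rfl
  · have := hj.2.2.add_le_of_lt hi.2.2 hji
    omega

lemma numOnes_eq_occ (k : ℕ) (x : List Bool) : numOnes k x = occ (List.replicate k true) x := rfl

lemma numOnes_append (s : List Bool) {t : List Bool} (ht : bits t 0 = false) :
    numOnes k (s ++ t) = numOnes k s + numOnes k t := by
  suffices straddle (List.replicate k true) s t = 0 by
    rw [numOnes_eq_occ, occ_append, this, add_zero, ← numOnes_eq_occ, ← numOnes_eq_occ]
  refine Finset.card_eq_zero.2 (Finset.filter_eq_empty_iff.2 fun i hi hones => ?_)
  rw [ones_prefix_drop_iff, List.length_replicate] at hones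
  have := hones.2 s.length (Finset.mem_range.1 hi).le hones.1
  rw [bits_append_right le_rfl, Nat.sub_self, ht] at this
  exact Bool.false_ne_true this

lemma bits_flatten_eq_false (hk : 1 ≤ k) {M : List (List Bool)} (hM : ∀ q ∈ M, pattern k <+: q)
    {e : ℕ} (he : e < k) : bits M.flatten e = false := by
  cases M with
  | nil => rfl
  | cons q M =>
    have : pattern k <+: (q :: M).flatten :=
      (hM q List.mem_cons_self).trans (List.prefix_append _ _)
    exact ((pattern_prefix_iff hk).1 this).1 e (Nat.zero_le e) (by omega)

lemma numOnes_flatten (hk : 1 ≤ k) {M : List (List Bool)}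
    (hM : ∀ q ∈ M.tail, pattern k <+: q) :
    numOnes k M.flatten = (M.map (numOnes k)).sum := by
  induction M with
  | nil => rfl
  | cons m M ih =>
    rw [List.flatten_cons, numOnes_append _ (bits_flatten_eq_false hk (M := M) hM hk),
      ih fun q hq => hM q (List.mem_of_mem_tail hq), List.map_cons, List.sum_cons]

end Pattern

/-! ### Parts -/

section Parts

variable {k : ℕ}

lemma parts_ne_nil (k : ℕ) (x : List Bool) : parts k x ≠ [] := by
  induction x with
  | nil => exact List.cons_ne_nil _ _
  | cons c t ih =>
    rw [parts]
    split
    · contradiction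
    · split_ifs <;> exact List.cons_ne_nil _ _

lemma exists_parts_eq_cons (k : ℕ) (x : List Bool) : ∃ q S, parts k x = q :: S :=
  List.exists_cons_of_ne_nil (parts_ne_nil k x)

lemma parts_cons (k : ℕ) (c : Bool) (t : List Bool) :
    parts k (c :: t) =
      (if pattern k <+: c :: t then [[]] else []) ++ (parts k t).modifyHead (c :: ·) := by
  obtain ⟨q, S, hq⟩ := exists_parts_eq_cons k t
  rw [parts, hq]
  split_ifs <;> rfl

lemma flatten_parts (k : ℕ) (x : List Bool) : (parts k x).flatten = x := by
  induction x with
  | nil => rfl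
  | cons c t ih =>
    obtain ⟨q, S, hq⟩ := exists_parts_eq_cons k t
    rw [hq, List.flatten_cons] at ih
    rw [parts_cons, hq]
    split_ifs <;> simp [ih]

lemma length_parts (k : ℕ) (x : List Bool) : (parts k x).length = occ (pattern k) x + 1 := by
  induction x with
  | nil => rfl
  | cons c t ih =>
    rw [parts_cons, occ_cons, List.length_append, List.length_modifyHead, ih]
    split_ifs <;> simp only [List.length_cons, List.length_nil] <;> omega

lemma parts_eq_singleton {x : List Bool} (hx : occ (pattern k) x = 0) : parts k x = [x] := by
  obtain ⟨q, hq⟩ := List.length_eq_one_iff.1 ((length_parts k x).trans (by rw [hx]))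
  have := flatten_parts k x
  rw [hq, List.flatten_singleton] at this
  rw [hq, this]

/-- Appending `b` to `a` only affects the last part of `a` and the first part of `b`. -/
lemma exists_parts_append (k : ℕ) (a : List Bool) :
    ∃ P p, parts k a = P ++ [p] ∧ ∀ b q S, parts k b = q :: S →
      ∃ m M, parts k (a ++ b) = P ++ m :: M ++ S ∧ (m :: M).flatten = p ++ q := by
  induction a with
  | nil => exact ⟨[], [], rfl, fun b q S hb => ⟨q, [], by simpa using hb, by simp⟩⟩
  | cons c a ih =>
    obtain ⟨P, p, ha, ih⟩ := ih
    cases P with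
    | nil =>
      refine ⟨if pattern k <+: c :: a then [[]] else [], c :: p, by rw [parts_cons, ha]; rfl,
        fun b q S hb => ?_⟩
      obtain ⟨m, M, hab, hM⟩ := ih b q S hb
      rw [List.cons_append, parts_cons, hab]
      by_cases hca : pattern k <+: c :: a
      · have hcab : pattern k <+: c :: (a ++ b) := hca.trans (List.prefix_append (c :: a) b)
        exact ⟨c :: m, M, by simp [hca, hcab], by simpa using hM⟩
      by_cases hcab : pattern k <+: c :: (a ++ b)
      · exact ⟨[], (c :: m) :: M, by simp [hca, hcab], by simpa using hM⟩
      · exact ⟨c :: m, M, by simp [hca, hcab], by simpa using hM⟩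
    | cons r R =>
      have pattern_fits : (pattern k).length ≤ (c :: a).length := by
        by_contra! hlt
        have := length_parts k a
        rw [ha, occ_eq_zero_of_length_lt (by rw [List.length_cons] at hlt; omega)] at this
        simp at this
      refine ⟨(if pattern k <+: c :: a then [[]] else []) ++ (c :: r) :: R, p,
        by rw [parts_cons, ha, List.append_assoc]; rfl, fun b q S hb => ?_⟩
      obtain ⟨m, M, hab, hM⟩ := ih b q S hb
      refine ⟨m, M, ?_, hM⟩
      have := prefix_append_iff (t := b) pattern_fits
      rw [List.cons_append] at this
      simp [parts_cons, hab, this]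

/-- The group `m :: M` has at most three parts: `u` is too short to contain the pattern, and at most
one occurrence of the pattern crosses each of its two ends. -/
lemma exists_parts_edit (hk : 1 ≤ k) (a b : List Bool) :
    ∃ P p q S, ∀ u : List Bool, u.length ≤ k → ∃ m M, parts k (a ++ u ++ b) = P ++ m :: M ++ S ∧
      (m :: M).flatten = p ++ u ++ q ∧ M.length ≤ 2 := by
  obtain ⟨P, p, ha, append_right⟩ := exists_parts_append k a
  obtain ⟨q, S, hb⟩ := exists_parts_eq_cons k b
  refine ⟨P, p, q, S, fun u hu => ?_⟩
  have occ_u : occ (pattern k) u = 0 :=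
    occ_eq_zero_of_length_lt (by rw [length_pattern]; omega)
  obtain ⟨P', u', hu', append_right'⟩ := exists_parts_append k u
  obtain ⟨rfl, rfl⟩ : [] = P' ∧ u = u' := by
    simpa [parts_eq_singleton occ_u, List.singleton_eq_append_iff, eq_comm] using hu'
  obtain ⟨m', M', hub, hM'⟩ := append_right' b q S hb
  obtain ⟨m, M, haub, hM⟩ := append_right (u ++ b) m' (M' ++ S) hub
  refine ⟨m, M ++ M', by simpa using haub, ?_, ?_⟩
  · rw [← List.cons_append, List.flatten_append, hM, List.append_assoc, List.append_assoc, ← hM',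
      List.flatten_cons]
  · have count := length_parts k (a ++ (u ++ b))
    have count_a := length_parts k a
    have count_b := length_parts k b
    rw [haub, occ_append, occ_append, occ_u] at count
    rw [ha] at count_a
    rw [hb] at count_b
    have := straddle_pattern_le_one hk a (u ++ b)
    have := straddle_pattern_le_one hk u b
    simp only [List.length_append, List.length_cons, List.length_nil] at count count_a count_b ⊢
    omega

lemma parts_append_of_forall_not_prefix {s t : List Bool}
    (hs : ∀ i < s.length, ¬ pattern k <+: (s ++ t).drop i) :
    parts k (s ++ t) = (parts k t).modifyHead (s ++ ·) := by
  induction s with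
  | nil => exact (congrFun List.modifyHead_id _).symm
  | cons c s ih =>
    have not_at_start : ¬ pattern k <+: c :: (s ++ t) := hs 0 (Nat.succ_pos _)
    rw [List.cons_append, parts_cons, if_neg not_at_start, List.nil_append,
      ih fun i hi => hs (i + 1) (Nat.succ_lt_succ hi), List.modifyHead_modifyHead]
    rfl

lemma pattern_prefix_of_mem_tail (hk : 1 ≤ k) (x : List Bool) :
    ∀ q ∈ (parts k x).tail, pattern k <+: q := by
  induction x with
  | nil => simp [parts]
  | cons c t ih =>
    rw [parts_cons]
    by_cases hp : pattern k <+: c :: t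
    · obtain ⟨w, hw⟩ : ∃ w, pattern k = c :: w := by
        obtain ⟨c', w, hw⟩ := List.exists_cons_of_length_pos (l := pattern k)
          (by rw [length_pattern]; omega)
        rw [hw] at hp ⊢
        exact ⟨w, by rw [(List.cons_prefix_cons.1 hp).1]⟩
      obtain ⟨t', rfl⟩ : w <+: t := by
        rw [hw] at hp
        exact (List.cons_prefix_cons.1 hp).2
      have no_overlap : ∀ i < w.length, ¬ pattern k <+: (w ++ t').drop i := fun i hi hpi => by
        have at_start := (pattern_prefix_drop_iff hk (i := 0)).1 hp
        have at_succ := (pattern_prefix_drop_iff hk (x := c :: (w ++ t')) (i := i + 1)).1 hpi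
        have := at_start.add_le_of_lt at_succ (Nat.succ_pos i)
        have := length_pattern k
        rw [hw, List.length_cons] at this
        omega
      have split := parts_append_of_forall_not_prefix no_overlap
      obtain ⟨q, S, hq⟩ := exists_parts_eq_cons k t'
      rw [split, hq] at ih ⊢
      simpa [hp, hw] using ih
    · obtain ⟨q, S, hq⟩ := exists_parts_eq_cons k t
      simpa [hp, hq] using ih

lemma map_length_parts_eq {x y : List Bool} (hlen : x.length = y.length)
    (hpat : ∀ i, pattern k <+: x.drop i ↔ pattern k <+: y.drop i) :
    (parts k x).map List.length = (parts k y).map List.length := by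
  induction x generalizing y with
  | nil => rw [List.eq_nil_of_length_eq_zero hlen.symm]
  | cons c t ih =>
    obtain ⟨c', t', rfl⟩ := List.exists_cons_of_length_eq_add_one hlen.symm
    have tails := ih (y := t') (by simpa using hlen) fun i => hpat (i + 1)
    have heads : pattern k <+: c :: t ↔ pattern k <+: c' :: t' := hpat 0
    obtain ⟨q, S, hq⟩ := exists_parts_eq_cons k t
    obtain ⟨q', S', hq'⟩ := exists_parts_eq_cons k t'
    rw [hq, hq', List.map_cons, List.map_cons, List.cons.injEq] at tails
    rw [parts_cons, parts_cons, hq, hq']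
    simp only [heads]
    split_ifs <;> simp [tails]

lemma numOnes_eq_sum_parts (hk : 1 ≤ k) (x : List Bool) :
    numOnes k x = ((parts k x).map (numOnes k)).sum := by
  rw [← numOnes_flatten hk (pattern_prefix_of_mem_tail hk x), flatten_parts]

end Parts

/-! ### The parities `d` -/

/-- Any two positions at which `X` and `Y` differ are less than `k` apart. -/
def DifferWithin (k : ℕ) (X Y : ℕ → Bool) : Prop :=
  ∀ e e', X e ≠ Y e → X e' ≠ Y e' → e < e' + k

lemma DifferWithin.symm {k : ℕ} {X Y : ℕ → Bool} (hXY : DifferWithin k X Y) :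
    DifferWithin k Y X :=
  fun e e' he he' => hXY e e' he.symm he'.symm

section Bits

variable {k : ℕ} {x y s t s' t' : List Bool}

lemma eq_of_bits_eq (hlen : x.length = y.length) (hbits : ∀ e < x.length, bits x e = bits y e) :
    x = y := by
  refine List.ext_getElem hlen fun e hx hy => ?_
  have := hbits e hx
  rwa [bits, bits, List.getD_eq_getElem _ _ hx, List.getD_eq_getElem _ _ hy] at this

lemma bits_of_length_le {e : ℕ} (he : x.length ≤ e) : bits x e = false :=
  List.getD_eq_default _ _ he

lemma lt_length_of_bits_ne (hlen : x.length = y.length) {e : ℕ} (he : bits x e ≠ bits y e) :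
    e < x.length := by
  by_contra! hle
  exact he (by rw [bits_of_length_le hle, bits_of_length_le (hlen ▸ hle)])

lemma DifferWithin.left (hlen : s.length = t.length)
    (hst : DifferWithin k (bits (s ++ s')) (bits (t ++ t'))) :
    DifferWithin k (bits s) (bits t) := by
  have lift (e : ℕ) (he : bits s e ≠ bits t e) : bits (s ++ s') e ≠ bits (t ++ t') e := by
    have := lt_length_of_bits_ne hlen he
    rwa [bits_append_left this, bits_append_left (hlen ▸ this)]
  exact fun e e' he he' => hst e e' (lift e he) (lift e' he')

lemma bits_length_add (s t : List Bool) (e : ℕ) : bits (s ++ t) (s.length + e) = bits t e := by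
  rw [bits_append_right (Nat.le_add_right _ _), Nat.add_sub_cancel_left]

lemma DifferWithin.right (hlen : s.length = t.length)
    (hst : DifferWithin k (bits (s ++ s')) (bits (t ++ t'))) :
    DifferWithin k (bits s') (bits t') := by
  have lift (e : ℕ) (he : bits s' e ≠ bits t' e) :
      bits (s ++ s') (s.length + e) ≠ bits (t ++ t') (s.length + e) := by
    rwa [bits_length_add, hlen, bits_length_add]
  intro e e' he he'
  have := hst _ _ (lift e he) (lift e' he')
  omega

end Bits

section Parities

variable {k : ℕ}

/-- The parity of the bits of `x` at the positions congruent to `j` modulo `k`, a binary digit of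
`d k x`. -/
def residueParity (k : ℕ) (x : List Bool) (j : ℕ) : Fin 2 :=
  Fin.ofNat 2 (∑ i ∈ Finset.range x.length with i % k = j, (bits x i).toNat)

lemma d_eq_finFunctionFinEquiv (k : ℕ) (x : List Bool) :
    d k x = finFunctionFinEquiv fun j : Fin k => residueParity k x j.rev := by
  rw [finFunctionFinEquiv_apply_val, d, Finset.sum_range,
    ← Equiv.sum_comp Fin.revPerm]
  refine Finset.sum_congr rfl fun j _ => ?_
  rw [Fin.revPerm_apply, show k - 1 - (j.rev : ℕ) = j by rw [Fin.val_rev]; omega]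
  rfl

lemma d_lt (k : ℕ) (x : List Bool) : d k x < 2 ^ k :=
  (d_eq_finFunctionFinEquiv k x).trans_lt (Fin.is_lt _)

lemma residueParity_eq_of_d_eq {x y : List Bool} (hd : d k x = d k y) {j : ℕ} (hj : j < k) :
    residueParity k x j = residueParity k y j := by
  rw [d_eq_finFunctionFinEquiv, d_eq_finFunctionFinEquiv, Fin.val_inj,
    EmbeddingLike.apply_eq_iff_eq] at hd
  simpa only [Fin.rev_rev] using congrFun hd (Fin.rev ⟨j, hj⟩)

lemma eq_of_d_eq (hk : 1 ≤ k) {x y : List Bool} (hlen : x.length = y.length)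
    (hxy : DifferWithin k (bits x) (bits y)) (hd : d k x = d k y) : x = y := by
  refine eq_of_bits_eq hlen fun e _ => ?_
  by_contra he
  let S := (Finset.range x.length).filter fun i => i % k = e % k
  have e_mem : e ∈ S := by
    simpa [S] using lt_length_of_bits_ne hlen he
  have agree_on_rest : ∀ i ∈ S.erase e, (bits x i).toNat = (bits y i).toNat := by
    intro i hi
    rw [Finset.mem_erase, Finset.mem_filter] at hi
    by_contra hne
    have hne : bits x i ≠ bits y i := fun heq => hne (by rw [heq])
    refine hi.1 (Nat.ModEq.eq_of_abs_lt (m := k) hi.2.2.symm ?_).symm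
    have := hxy e i he hne
    have := hxy i e hne he
    rw [abs_lt]
    omega
  have parity_eq := congrArg Fin.val (residueParity_eq_of_d_eq hd (Nat.mod_lt e hk))
  simp only [residueParity, Fin.val_ofNat, ← hlen] at parity_eq
  change (∑ i ∈ S, _) % 2 = (∑ i ∈ S, _) % 2 at parity_eq
  rw [← Finset.add_sum_erase _ _ e_mem, ← Finset.add_sum_erase _ _ e_mem,
    Finset.sum_congr rfl agree_on_rest] at parity_eq
  cases hx : bits x e <;> cases hy : bits y e <;> simp_all <;> omega

lemma eq_of_head_ne (hk : 1 ≤ k) {m m' : List Bool} {M M' : List (List Bool)}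
    (hm : m.length = m'.length) (hne : m ≠ m') (hlen : M.map List.length = M'.map List.length)
    (hpat : ∀ q ∈ M, pattern k <+: q) (hpat' : ∀ q ∈ M', pattern k <+: q)
    (hclose : DifferWithin k (bits (m ++ M.flatten)) (bits (m' ++ M'.flatten))) : M = M' := by
  obtain ⟨e, he⟩ : ∃ e, bits m e ≠ bits m' e := by
    by_contra! hbits
    exact hne (eq_of_bits_eq hm fun e _ => hbits e)
  have e_lt := lt_length_of_bits_ne hm he
  have flatten_eq : M.flatten = M'.flatten := by
    refine eq_of_bits_eq (by rw [List.length_flatten, List.length_flatten, hlen])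
      fun e' _ => ?_
    by_contra he'
    have : m.length + e' < e + k := by
      refine hclose _ _ ?_ ?_
      · rwa [bits_length_add, hm, bits_length_add]
      · rwa [bits_append_left e_lt, bits_append_left (hm ▸ e_lt)]
    exact he' (by rw [bits_flatten_eq_false hk hpat (by omega),
      bits_flatten_eq_false hk hpat' (by omega)])
  exact List.eq_iff_flatten_eq.2 ⟨flatten_eq, hlen⟩

/-- A local change that keeps the lengths of all parts changes only one part, because the first `k`
bits of the next part are zeros before and after the change. -/
lemma eq_of_sum_d_eq (hk : 1 ≤ k) {M M' : List (List Bool)}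
    (hlen : M.map List.length = M'.map List.length)
    (hpat : ∀ q ∈ M.tail, pattern k <+: q) (hpat' : ∀ q ∈ M'.tail, pattern k <+: q)
    (hclose : DifferWithin k (bits M.flatten) (bits M'.flatten))
    (hd : (M.map (d k)).sum = (M'.map (d k)).sum) : M = M' := by
  induction M generalizing M' with
  | nil => simpa [eq_comm] using hlen
  | cons m M ih =>
    obtain ⟨m', M', rfl⟩ : ∃ m₁ M₁, M' = m₁ :: M₁ :=
      List.exists_cons_of_ne_nil fun h => by simp [h] at hlen
    rw [List.map_cons, List.map_cons, List.cons.injEq] at hlen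
    rw [List.flatten_cons, List.flatten_cons] at hclose
    rw [List.map_cons, List.map_cons, List.sum_cons, List.sum_cons] at hd
    rcases eq_or_ne m m' with rfl | hne
    · rw [ih hlen.2 (fun q hq => hpat q (List.mem_of_mem_tail hq))
        (fun q hq => hpat' q (List.mem_of_mem_tail hq)) (hclose.right rfl)
        (Nat.add_left_cancel hd)]
    · have rest_eq := eq_of_head_ne hk hlen.1 hne hlen.2 hpat hpat' hclose
      subst rest_eq
      exact absurd (eq_of_d_eq hk hlen.1 (hclose.left hlen.1) (Nat.add_right_cancel hd)) hne

end Parities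

/-! ### Occurrences of `1^k` when an occurrence of the pattern moves -/

/-- The bit sequences `X` and `Y` differ only locally, `X` has an occurrence of the pattern at `i`
which is lost in `Y`, and `Y` has a new occurrence further to the right, at `j`. -/
structure PatternMovesRight (k : ℕ) (X Y : ℕ → Bool) (i j : ℕ) : Prop where
  differWithin : DifferWithin k X Y
  lt : i < j
  old : PatternAt k X i
  lost : ¬ PatternAt k Y i
  new : PatternAt k Y j
  not_before : ¬ PatternAt k X j

section PatternMoves

variable {k : ℕ} {X Y : ℕ → Bool} {i j : ℕ}

lemma PatternAt.exists_ne (hX : PatternAt k X i) (hY : ¬ PatternAt k Y i) :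
    ∃ g, i ≤ g ∧ g < i + 2 * k ∧ X g ≠ Y g := by
  by_contra! agree
  exact hY ⟨fun e hie hek => by rw [← agree e hie (by omega), hX.1 e hie hek],
    fun e hie hek => by rw [← agree e (by omega) (by omega), hX.2 e hie hek]⟩

namespace PatternMovesRight

lemma ne_of_mem_both (hm : PatternMovesRight k X Y i j) {e : ℕ}
    (hi : i + k ≤ e) (hi' : e < i + 2 * k) (hj : j ≤ e) (hj' : e < j + k) : X e ≠ Y e := by
  rw [hm.old.2 e hi (by omega), hm.new.1 e hj hj']
  exact Bool.noConfusion

lemma le_of_ne (hm : PatternMovesRight k X Y i j) {e : ℕ} (he : X e ≠ Y e) : i + k ≤ e := by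
  by_contra! hlt
  have := hm.lt
  obtain ⟨g, _, _, hg⟩ := hm.old.exists_ne hm.lost
  obtain ⟨g', _, _, hg'⟩ := hm.new.exists_ne hm.not_before
  have := hm.differWithin g' e hg'.symm he
  have := hm.differWithin g e hg he
  have := hm.differWithin (min (i + 2 * k) (j + k) - 1) e
    (hm.ne_of_mem_both (by omega) (by omega) (by omega) (by omega)) he
  exact he ((hm.old.1 e (by omega) hlt).trans (hm.new.1 e (by omega) (by omega)).symm)

lemma lt_of_ne (hm : PatternMovesRight k X Y i j) {e : ℕ} (he : X e ≠ Y e) : e < j + k := by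
  by_contra! hle
  have := hm.lt
  obtain ⟨g, _, _, hg⟩ := hm.old.exists_ne hm.lost
  have := hm.differWithin e g he hg
  have := hm.differWithin e (max (i + k) j) he
    (hm.ne_of_mem_both (by omega) (by omega) (by omega) (by omega))
  exact he ((hm.old.2 e (by omega) (by omega)).trans (hm.new.2 e hle (by omega)).symm)

lemma exists_eq_false (hm : PatternMovesRight k X Y i j) :
    ∃ g, i + k ≤ g ∧ g < i + 2 * k ∧ X g ≠ Y g ∧ Y g = false := by
  obtain ⟨g, _, hgi, hg⟩ := hm.old.exists_ne hm.lost
  have hig := hm.le_of_ne hg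
  refine ⟨g, hig, hgi, hg, ?_⟩
  rw [hm.old.2 g hig (by omega)] at hg
  simpa using hg.symm

lemma not_onesAt (hm : PatternMovesRight k X Y i j) : ¬ OnesAt k Y (i + k) := by
  obtain ⟨g, hig, hgi, _, hg⟩ := hm.exists_eq_false
  intro ones
  simpa [hg] using ones g hig (by omega)

lemma onesAt_of_onesAt (hm : PatternMovesRight k X Y i j) {o : ℕ}
    (ho : OnesAt k Y o) : OnesAt k X o := by
  intro e hoe heo
  by_contra he
  have he : X e ≠ Y e := by rwa [ho e hoe heo]
  have := hm.le_of_ne he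
  have := hm.lt_of_ne he
  have start_ge : i + k ≤ o := by
    by_contra! hlt
    have last_zero : X (i + k - 1) = Y (i + k - 1) := by
      by_contra hne
      have := hm.le_of_ne hne
      omega
    rw [hm.old.1 _ (by omega) (by omega), ho _ (by omega) (by omega)] at last_zero
    exact Bool.false_ne_true last_zero
  have end_le : o + k ≤ j := by
    by_contra! hlt
    have overlap := hm.new.1 (max o j) (by omega) (by omega)
    rw [ho _ (by omega) (by omega)] at overlap
    exact Bool.false_ne_true overlap.symm
  obtain ⟨g, _, hgi, hne, hg⟩ := hm.exists_eq_false
  obtain ⟨g', hjg', _, hne'⟩ := hm.new.exists_ne hm.not_before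
  have := hm.differWithin g' g hne'.symm hne
  have ones_at_g := ho g (by omega) (by omega)
  exact Bool.false_ne_true (hg.symm.trans ones_at_g)

end PatternMovesRight

/-- When an occurrence of the pattern moves to the right, its block of ones at `i + k` is broken,
and no new occurrence of `1^k` can arise. -/
lemma numOnes_lt_of_patternMovesRight (hk : 1 ≤ k) {x y : List Bool} (hlen : x.length = y.length)
    (hm : PatternMovesRight k (bits x) (bits y) i j) : numOnes k y < numOnes k x := by
  refine Finset.card_lt_card (Finset.ssubset_iff_of_subset (fun o ho => ?_) |>.2 ⟨i + k, ?_, ?_⟩)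
  · rw [Finset.mem_filter, ones_prefix_drop_iff, Finset.mem_range] at ho ⊢
    exact ⟨hlen ▸ ho.1, hm.onesAt_of_onesAt ho.2⟩
  · rw [Finset.mem_filter, ones_prefix_drop_iff, Finset.mem_range]
    exact ⟨lt_length_of_bits (hm.old.2 (i + k) le_rfl (by omega)), hm.old.2⟩
  · rw [Finset.mem_filter, ones_prefix_drop_iff]
    exact fun ho => hm.not_onesAt ho.2

/-- The positions of the occurrences of the pattern in `x`. -/
def patternPositions (k : ℕ) (x : List Bool) : Finset ℕ :=
  (Finset.range x.length).filter fun i => pattern k <+: x.drop i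

lemma mem_patternPositions (hk : 1 ≤ k) {x : List Bool} :
    i ∈ patternPositions k x ↔ pattern k <+: x.drop i := by
  rw [patternPositions, Finset.mem_filter, Finset.mem_range, and_iff_right_iff_imp]
  intro hi
  have := hi.length_le
  rw [length_pattern, List.length_drop] at this
  omega

lemma patternPositions_eq (hk : 1 ≤ k) {x y : List Bool} (hlen : x.length = y.length)
    (hxy : DifferWithin k (bits x) (bits y)) (hocc : occ (pattern k) x = occ (pattern k) y)
    (hones : numOnes k x = numOnes k y) : patternPositions k x = patternPositions k y := by
  by_contra hne
  obtain ⟨i, hi⟩ : (patternPositions k x \ patternPositions k y).Nonempty := Finset.sdiff_nonempty.2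
    fun hsub => hne (Finset.eq_of_subset_of_card_le hsub hocc.ge)
  obtain ⟨j, hj⟩ : (patternPositions k y \ patternPositions k x).Nonempty := Finset.sdiff_nonempty.2
    fun hsub => hne (Finset.eq_of_subset_of_card_le hsub hocc.le).symm
  simp only [Finset.mem_sdiff, mem_patternPositions hk, pattern_prefix_drop_iff hk] at hi hj
  rcases lt_trichotomy i j with hij | rfl | hji
  · exact (numOnes_lt_of_patternMovesRight hk hlen ⟨hxy, hij, hi.1, hi.2, hj.1, hj.2⟩).ne' hones
  · exact hi.2 hj.1
  · exact (numOnes_lt_of_patternMovesRight hk hlen.symm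
      ⟨hxy.symm, hji, hj.1, hj.2, hi.1, hi.2⟩).ne hones

end PatternMoves

/-! ### The effect of an edit on the parts -/

lemma bits_eq_of_outside {a w w' b : List Bool} (hw : w.length = w'.length) {i : ℕ}
    (hi : i < a.length ∨ a.length + w.length ≤ i) :
    bits (a ++ w ++ b) i = bits (a ++ w' ++ b) i := by
  rw [List.append_assoc, List.append_assoc]
  rcases hi with hi | hi
  · rw [bits_append_left hi, bits_append_left hi]
  · rw [bits_append_right (by omega), bits_append_right (by omega), bits_append_right (by omega),
      bits_append_right (by omega), hw]

lemma SubstringEdit.symm {k : ℕ} {x y : List Bool} (hxy : SubstringEdit k x y) :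
    SubstringEdit k y x := by
  obtain ⟨a, u, v, b, hu, hv, hx, hy⟩ := hxy
  exact ⟨a, v, u, b, hv, hu, hy, hx⟩

namespace SubstringEdit

variable {k : ℕ} {x y : List Bool}

lemma append_append (hxy : SubstringEdit k x y) (s t : List Bool) :
    SubstringEdit k (s ++ x ++ t) (s ++ y ++ t) := by
  obtain ⟨a, u, v, b, hu, hv, rfl, rfl⟩ := hxy
  exact ⟨s ++ a, u, v, b ++ t, hu, hv, by simp only [List.append_assoc],
    by simp only [List.append_assoc]⟩

lemma differWithin (hxy : SubstringEdit k x y) (hlen : x.length = y.length) :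
    DifferWithin k (bits x) (bits y) := by
  obtain ⟨a, u, v, b, _, hv, rfl, rfl⟩ := hxy
  have huv : u.length = v.length := by simpa using hlen
  have mem_window (e : ℕ) (he : bits (a ++ u ++ b) e ≠ bits (a ++ v ++ b) e) :
      a.length ≤ e ∧ e < a.length + u.length := by
    contrapose! he
    exact bits_eq_of_outside huv (by omega)
  intro e e' he he'
  have := mem_window e he
  have := mem_window e' he'
  omega

lemma length_le (hxy : SubstringEdit k x y) : x.length ≤ y.length + k := by
  obtain ⟨a, u, v, b, hu, _, rfl, rfl⟩ := hxy
  simp only [List.length_append]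
  omega

lemma numOnes_le (hxy : SubstringEdit k x y) : numOnes k x ≤ numOnes k y + 3 * k := by
  obtain ⟨a, u, v, b, hu, _, rfl, rfl⟩ := hxy
  simp only [numOnes_eq_occ, List.append_assoc, occ_append]
  have := occ_le_length (List.replicate k true) u
  have := straddle_le_length_left (List.replicate k true) u b
  have := straddle_le_length (List.replicate k true) a (u ++ b)
  rw [List.length_replicate] at this
  omega

end SubstringEdit

/-- The parts of `x` and `y` agree except for two short groups `M` and `M'` of consecutive parts,
and these groups arise from each other by an edit of their concatenations. -/
structure PartsEdit (k : ℕ) (x y : List Bool) (P M M' S : List (List Bool)) : Prop where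
  parts_left : parts k x = P ++ M ++ S
  parts_right : parts k y = P ++ M' ++ S
  length_pos_left : 1 ≤ M.length
  length_pos_right : 1 ≤ M'.length
  length_le_left : M.length ≤ 3
  length_le_right : M'.length ≤ 3
  edit : SubstringEdit k M.flatten M'.flatten

lemma exists_partsEdit {k : ℕ} (hk : 1 ≤ k) {x y : List Bool} (hxy : SubstringEdit k x y) :
    ∃ P M M' S, PartsEdit k x y P M M' S := by
  obtain ⟨a, u, v, b, hu, hv, rfl, rfl⟩ := hxy
  obtain ⟨P, p, q, S, hparts⟩ := exists_parts_edit hk a b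
  obtain ⟨m, M, hx, hM, hM_le⟩ := hparts u hu
  obtain ⟨m', M', hy, hM', hM'_le⟩ := hparts v hv
  exact ⟨P, m :: M, m' :: M', S, hx, hy, Nat.succ_pos _, Nat.succ_pos _, Nat.succ_le_succ hM_le,
    Nat.succ_le_succ hM'_le, p, u, v, q, hu, hv, hM, hM'⟩

section Sums

variable {k : ℕ}

lemma sum_d_lt {M : List (List Bool)} (hM : M.length ≤ 3) : (M.map (d k)).sum < B k := by
  have hpow := Nat.one_le_two_pow (n := k)
  have hsum : (M.map (d k)).sum ≤ M.length * (2 ^ k - 1) := by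
    rw [← List.length_map (d k), ← smul_eq_mul]
    refine List.sum_le_card_nsmul _ _ fun z hz => ?_
    obtain ⟨q, _, rfl⟩ := List.mem_map.1 hz
    exact Nat.le_sub_one_of_lt (d_lt k q)
  have := Nat.mul_le_mul_right (2 ^ k - 1) hM
  rw [B]
  omega

lemma sum_f_eq (hk : 1 ≤ k) {M : List (List Bool)} (hM : ∀ q ∈ M.tail, pattern k <+: q) :
    (M.map (f k)).sum =
      (M.map (d k)).sum + B k * numOnes k M.flatten + C k * M.flatten.length := by
  rw [numOnes_flatten hk hM, List.length_flatten]
  rw [show f k = fun q => d k q + B k * numOnes k q + C k * q.length from rfl]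
  simp only [List.sum_map_add, List.sum_map_mul_left]

lemma eq_of_add_mul_eq {r r' c l l' : ℕ} (hr : r < r' + c) (hr' : r' < r + c)
    (heq : r + c * l = r' + c * l') : l = l' := by
  rcases lt_trichotomy l l' with hlt | rfl | hlt
  · have := Nat.mul_le_mul_left c (Nat.succ_le_of_lt hlt)
    rw [Nat.mul_succ] at this
    omega
  · rfl
  · have := Nat.mul_le_mul_left c (Nat.succ_le_of_lt hlt)
    rw [Nat.mul_succ] at this
    omega

lemma add_B_mul_lt (hk : 1 ≤ k) {r n n' : ℕ} (hr : r < B k) (hn : n ≤ n' + 3 * k) :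
    r + B k * n < B k * n' + C k := by
  have : B k * n ≤ B k * n' + 9 * (k * 2 ^ k) :=
    (Nat.mul_le_mul_left _ hn).trans_eq (by rw [B]; ring)
  have : B k ≤ 3 * (k * 2 ^ k) := Nat.mul_le_mul_left 3 (Nat.le_mul_of_pos_left _ hk)
  have : C k = 40 * (k * 2 ^ k) := by rw [C]; ring
  omega

end Sums

namespace PartsEdit

variable {k : ℕ} {x y : List Bool} {P M M' S : List (List Bool)}

lemma symm (he : PartsEdit k x y P M M' S) : PartsEdit k y x P M' M S :=
  ⟨he.parts_right, he.parts_left, he.length_pos_right, he.length_pos_left, he.length_le_right,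
    he.length_le_left, he.edit.symm⟩

lemma pattern_prefix (hk : 1 ≤ k) (he : PartsEdit k x y P M M' S) :
    ∀ q ∈ M.tail, pattern k <+: q := by
  refine fun q hq => pattern_prefix_of_mem_tail hk x q ?_
  rw [he.parts_left]
  cases P with
  | nil =>
    rw [List.nil_append, List.tail_append_of_ne_nil (List.ne_nil_of_length_pos he.length_pos_left)]
    exact List.mem_append_left _ hq
  | cons p P =>
    simp [List.mem_of_mem_tail hq]

lemma sum_f_lt (hk : 1 ≤ k) (he : PartsEdit k x y P M M' S) :
    (M.map (f k)).sum < (M'.map (f k)).sum + 2 * k * C k := by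
  rw [sum_f_eq hk (he.pattern_prefix hk), sum_f_eq hk (he.symm.pattern_prefix hk)]
  have := add_B_mul_lt hk (sum_d_lt he.length_le_left) he.edit.numOnes_le
  have := Nat.mul_le_mul_left (C k) he.edit.length_le
  have := Nat.mul_le_mul_left (C k) hk
  have := Nat.zero_le (M'.map (d k)).sum
  linarith

lemma eq_left (he : PartsEdit k x y P M M' S) : x = P.flatten ++ M.flatten ++ S.flatten := by
  rw [← flatten_parts k x, he.parts_left, List.flatten_append, List.flatten_append]

lemma map_length_eq (hk : 1 ≤ k) (he : PartsEdit k x y P M M' S)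
    (hcard : M.length = M'.length) (hlen : M.flatten.length = M'.flatten.length)
    (hones : numOnes k M.flatten = numOnes k M'.flatten) :
    M.map List.length = M'.map List.length := by
  have length_eq : x.length = y.length := by
    rw [he.eq_left, he.symm.eq_left]
    simp only [List.length_append, hlen]
  have numOnes_eq : numOnes k x = numOnes k y := by
    rw [numOnes_flatten hk (he.pattern_prefix hk),
      numOnes_flatten hk (he.symm.pattern_prefix hk)] at hones
    simp only [numOnes_eq_sum_parts hk, he.parts_left, he.parts_right, List.map_append,
      List.sum_append, hones]
  have occ_eq : occ (pattern k) x = occ (pattern k) y := by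
    have hx := length_parts k x
    have hy := length_parts k y
    rw [he.parts_left] at hx
    rw [he.parts_right] at hy
    simp only [List.length_append] at hx hy
    omega
  have differWithin : DifferWithin k (bits x) (bits y) := by
    have := (he.edit.append_append P.flatten S.flatten).differWithin (by simp [hlen])
    rwa [← he.eq_left, ← he.symm.eq_left] at this
  have positions_eq := patternPositions_eq hk length_eq differWithin occ_eq numOnes_eq
  have lengths_eq := map_length_parts_eq length_eq fun i => by
    rw [← mem_patternPositions hk, positions_eq, mem_patternPositions hk]
  rw [he.parts_left, he.parts_right] at lengths_eq
  simp only [List.map_append, List.append_assoc, List.append_cancel_left_eq] at lengths_eq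
  exact (List.append_inj lengths_eq (by simpa using hcard)).1

/-- The three summands of `f` have different scales, so the sum of the values of `f` over few parts
determines the length, the number of occurrences of `1^k` and the sum of the values of `d`. -/
lemma eq_of_sum_f_eq (hk : 1 ≤ k) (he : PartsEdit k x y P M M' S)
    (hcard : M.length = M'.length) (hsum : (M.map (f k)).sum = (M'.map (f k)).sum) : x = y := by
  rw [sum_f_eq hk (he.pattern_prefix hk), sum_f_eq hk (he.symm.pattern_prefix hk)] at hsum
  have hd := sum_d_lt (k := k) he.length_le_left
  have hd' := sum_d_lt (k := k) he.length_le_right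
  have length_eq : M.flatten.length = M'.flatten.length := by
    have := add_B_mul_lt hk hd he.edit.numOnes_le
    have := add_B_mul_lt hk hd' he.edit.symm.numOnes_le
    exact eq_of_add_mul_eq (by omega) (by omega) hsum
  rw [length_eq, Nat.add_right_cancel_iff] at hsum
  have numOnes_eq : numOnes k M.flatten = numOnes k M'.flatten :=
    eq_of_add_mul_eq (by omega) (by omega) hsum
  rw [numOnes_eq, Nat.add_right_cancel_iff] at hsum
  have map_length_eq : M.map List.length = M'.map List.length :=
    he.map_length_eq hk hcard length_eq numOnes_eq
  have M_eq := eq_of_sum_d_eq hk map_length_eq (he.pattern_prefix hk) (he.symm.pattern_prefix hk)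
    (he.edit.differWithin length_eq) hsum
  rw [he.eq_left, he.symm.eq_left, M_eq]

end PartsEdit

/-! ### The VT sketch -/

lemma VT_cons (c : ℕ) (l : List ℕ) : VT (c :: l) = c + VT l + l.sum := by
  have sum_getD : ∑ i ∈ Finset.range l.length, l.getD i 0 = l.sum := by
    simp [Finset.sum_range]
  rw [VT, VT, List.length_cons, Finset.sum_range_succ', ← sum_getD, add_assoc c,
    ← Finset.sum_add_distrib, add_comm]
  simp only [List.getD_cons_succ, List.getD_cons_zero, zero_add, one_mul, add_mul]

lemma VT_append (l l' : List ℕ) : VT (l ++ l') = VT l + VT l' + l.length * l'.sum := by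
  induction l with
  | nil => simp [VT]
  | cons c l ih =>
    rw [List.cons_append, VT_cons, VT_cons, ih]
    simp only [List.sum_append, List.length_cons]
    ring

lemma VT_le (l : List ℕ) : VT l ≤ l.length * l.sum := by
  induction l with
  | nil => simp [VT]
  | cons c l ih =>
    rw [VT_cons, List.length_cons, List.sum_cons]
    have := Nat.zero_le (l.length * c)
    linarith

lemma VT_sub_VT_eq (P R S : List ℕ) {M M' N N' : List ℕ}
    (hlen : M.length + N'.length = M'.length + N.length)
    (hsum : M.sum + N'.sum = M'.sum + N.sum) :
    (VT (P ++ M ++ R ++ N' ++ S) - VT (P ++ M' ++ R ++ N ++ S) : ℤ) =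
      VT (M ++ N') - VT (M' ++ N) + (M.length - M'.length) * R.sum -
        R.length * (M.sum - M'.sum) := by
  simp only [VT_append, List.length_append]
  have sum_eq : (N'.sum : ℤ) = M'.sum + N.sum - M.sum := by omega
  have length_eq : (N'.length : ℤ) = M'.length + N.length - M.length := by omega
  simp only [Nat.cast_add, Nat.cast_mul]
  rw [sum_eq, length_eq]
  ring

lemma le_abs_of_add_mul_eq_mul {e t σ l s D : ℤ} (hl : 0 ≤ l) (hσ : l * D ≤ σ) (hs : |s| < D)
    (hne : t = 0 → s ≠ 0) (heq : e + t * σ = l * s) : l ≤ |e| := by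
  have abs_mul_s : |l * s| = l * |s| := by rw [abs_mul, abs_of_nonneg hl]
  rcases eq_or_ne t 0 with rfl | ht
  · rw [zero_mul, add_zero] at heq
    rw [heq, abs_mul_s]
    exact le_mul_of_one_le_right hl (Int.one_le_abs (hne rfl))
  · have hσ_nonneg : 0 ≤ σ := (mul_nonneg hl (hs.trans_le' (abs_nonneg s)).le).trans hσ
    have σ_le : σ ≤ |t * σ| := by
      rw [abs_mul, abs_of_nonneg hσ_nonneg]
      exact le_mul_of_one_le_left hσ_nonneg (Int.one_le_abs ht)
    have mul_s_le : l * |s| ≤ l * (D - 1) := mul_le_mul_of_nonneg_left (Int.le_sub_one_of_lt hs) hl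
    have triangle : |t * σ| ≤ |l * s| + |e| := by
      rw [show t * σ = l * s - e by linarith]
      exact abs_sub _ _
    linarith

/-- Read modulo the large number `Q`, the difference of the sketches is an exact identity in which
the common segment `R` contributes the product of its length with a nonzero number. -/
lemma length_le_of_VT_modEq {P M M' R N N' S : List ℕ} {D Q : ℕ}
    (hM : M.length ≤ 3) (hM' : M'.length ≤ 3) (hN : N.length ≤ 3) (hN' : N'.length ≤ 3)
    (ht : |(M.length - M'.length : ℤ)| ≤ 2)
    (hlen : M.length + N'.length = M'.length + N.length) (hsum : M.sum + N'.sum = M'.sum + N.sum)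
    (hD : |(M.sum - M'.sum : ℤ)| < D)
    (hne : M.length = M'.length → M.sum ≠ M'.sum) (hR : ∀ r ∈ R, D ≤ r)
    (hQ : 9 * (P ++ M ++ R ++ N' ++ S).sum < Q)
    (hVT : VT (P ++ M ++ R ++ N' ++ S) ≡ VT (P ++ M' ++ R ++ N ++ S) [MOD Q]) :
    R.length ≤ 6 * (M.sum + N'.sum) := by
  have hRD : (R.length * D : ℤ) ≤ R.sum := by
    exact_mod_cast List.card_nsmul_le_sum R D hR
  have hR_nonneg : (0 : ℤ) ≤ R.length := Int.natCast_nonneg _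
  have abs_VT_sub : |(VT (M ++ N') - VT (M' ++ N) : ℤ)| ≤ (6 * (M.sum + N'.sum) : ℕ) := by
    have hMN : VT (M ++ N') ≤ 6 * (M.sum + N'.sum) :=
      (VT_le _).trans (Nat.mul_le_mul (by simp only [List.length_append]; omega) (by simp))
    have hMN' : VT (M' ++ N) ≤ 6 * (M.sum + N'.sum) :=
      (VT_le _).trans (Nat.mul_le_mul (by simp only [List.length_append]; omega) (by simp [hsum]))
    rw [abs_le]
    omega
  have hdvd := (Nat.modEq_iff_dvd.1 hVT.symm)
  rw [VT_sub_VT_eq P R S hlen hsum] at hdvd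
  have eq_zero := Int.eq_zero_of_abs_lt_dvd hdvd <| by
    have sum_R_le : |(M.length - M'.length : ℤ) * R.sum| ≤ 2 * R.sum := by
      rw [abs_mul, Nat.abs_cast]
      exact mul_le_mul_of_nonneg_right ht (Int.natCast_nonneg _)
    have length_R_le : |(R.length * (M.sum - M'.sum) : ℤ)| ≤ R.sum := by
      rw [abs_mul, Nat.abs_cast]
      exact (mul_le_mul_of_nonneg_left hD.le hR_nonneg).trans hRD
    refine (abs_sub _ _).trans_lt ((add_le_add_left (abs_add_le _ _) _).trans_lt ?_)
    simp only [List.sum_append] at hQ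
    omega
  have := le_abs_of_add_mul_eq_mul hR_nonneg hRD hD
    (fun h => by have := hne (by omega); omega) (sub_eq_zero.1 eq_zero)
  exact_mod_cast this.trans abs_VT_sub

/-! ### Confining the difference of two codewords -/

/-- The strings `x` and `x'` have the same length and can be turned into the same string by one
edit each, so a code that corrects one edit contains at most one of them. -/
def Confusable (k : ℕ) (x x' : List Bool) : Prop :=
  x.length = x'.length ∧ ∃ y, SubstringEdit k x y ∧ SubstringEdit k x' y

/-- The strings `x` and `x'` agree outside two windows of the same length, at most `l`, at the same
position. -/
def AgreeOutside (l : ℕ) (x x' : List Bool) : Prop :=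
  ∃ a w w' b, x = a ++ w ++ b ∧ x' = a ++ w' ++ b ∧ w.length = w'.length ∧ w.length ≤ l

lemma AgreeOutside.symm {l : ℕ} {x x' : List Bool} (hx : AgreeOutside l x x') :
    AgreeOutside l x' x := by
  obtain ⟨a, w, w', b, hx, hx', hw, hl⟩ := hx
  exact ⟨a, w', w, b, hx', hx, hw.symm, hw ▸ hl⟩

section Size

variable {k : ℕ}

lemma two_mul_C_le_f {q : List Bool} (hq : pattern k <+: q) : 2 * k * C k ≤ f k q := by
  have length_le := Nat.mul_le_mul_left (C k) hq.length_le
  rw [length_pattern] at length_le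
  rw [f]
  linarith [Nat.zero_le (d k q), Nat.zero_le (B k * numOnes k q)]

lemma sum_f_le (M : List (List Bool)) :
    (M.map (f k)).sum ≤ M.length * 2 ^ k + (B k + C k) * M.flatten.length := by
  induction M with
  | nil => simp
  | cons q M ih =>
    have d_le := (d_lt k q).le
    have numOnes_le : B k * numOnes k q ≤ B k * q.length :=
      Nat.mul_le_mul_left _ (numOnes_eq_occ k q ▸ occ_le_length _ _)
    simp only [List.map_cons, List.sum_cons, List.length_cons, List.flatten_cons,
      List.length_append, f]
    linarith

lemma sum_fString_lt (hk : 1 ≤ k) {x : List Bool} (hx : x ≠ []) :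
    9 * (fString k x).sum < 2000 * C k * x.length := by
  have sum_le := sum_f_le (k := k) (parts k x)
  have occ_le := occ_le_length (pattern k) x
  rw [flatten_parts, length_parts] at sum_le
  have length_pos := List.length_pos_iff.2 hx
  have count_le : (occ (pattern k) x + 1) * 2 ^ k ≤ 2 * x.length * 2 ^ k :=
    Nat.mul_le_mul_right _ (by omega)
  have le_mul_k : 2 ^ k * x.length ≤ k * (2 ^ k * x.length) := Nat.le_mul_of_pos_left _ hk
  have pos : 0 < 2 ^ k * x.length := by positivity
  simp only [B, C, fString] at sum_le ⊢
  linarith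

end Size

section CommonDescendant

variable {k : ℕ} {x x' y : List Bool} {P M M' R N N' S : List (List Bool)}

lemma PartsEdit.fString_eq (he : PartsEdit k x y P M M' S) :
    fString k x = P.map (f k) ++ M.map (f k) ++ S.map (f k) := by
  rw [fString, he.parts_left, List.map_append, List.map_append]

lemma PartsEdit.sum_f_add_sum_f_eq (hk : 1 ≤ k) (he : PartsEdit k x y P M M' (R ++ N' ++ S))
    (he' : PartsEdit k x' y (P ++ M' ++ R) N N' S)
    (hsum : (fString k x).sum ≡ (fString k x').sum [MOD 10 * C k * k]) :
    (M.map (f k)).sum + (N'.map (f k)).sum = (M'.map (f k)).sum + (N.map (f k)).sum := by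
  have sum_M_lt := he.sum_f_lt hk
  have sum_M'_lt := he.symm.sum_f_lt hk
  have sum_N_lt := he'.sum_f_lt hk
  have sum_N'_lt := he'.symm.sum_f_lt hk
  refine Nat.ModEq.eq_of_abs_lt (m := 10 * C k * k) ?_ ?_
  · refine Nat.ModEq.add_right_cancel'
      ((P.map (f k)).sum + (R.map (f k)).sum + (S.map (f k)).sum) ?_
    rw [he.fString_eq, he'.fString_eq] at hsum
    simp only [List.map_append, List.sum_append] at hsum
    convert hsum using 1 <;> ring
  · rw [show 10 * C k * k = 5 * (2 * k * C k) by ring, abs_lt]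
    omega

/-- The case in which the edits of `x` and `x'` into `y` affect disjoint groups of parts, separated
by the parts `R`. -/
lemma PartsEdit.length_le_of_h_eq (hk : 1 ≤ k) (hne : x ≠ x') (hlen : x.length = x'.length)
    (hh : h k x.length x = h k x.length x') (he : PartsEdit k x y P M M' (R ++ N' ++ S))
    (he' : PartsEdit k x' y (P ++ M' ++ R) N N' S) :
    R.length ≤ 6 * ((M.map (f k)).sum + (N'.map (f k)).sum) := by
  have x_ne_nil : x ≠ [] := by
    rintro rfl
    exact hne (List.eq_nil_of_length_eq_zero hlen.symm).symm
  have pattern_prefix : ∀ r ∈ R, pattern k <+: r := by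
    refine fun r hr => pattern_prefix_of_mem_tail hk y r ?_
    obtain ⟨q, M'', rfl⟩ := List.exists_cons_of_length_pos he.length_pos_right
    rw [he'.parts_right]
    cases P <;> simp [hr]
  have fString_lt := sum_fString_lt hk x_ne_nil
  simp only [h, Prod.mk.injEq] at hh
  obtain ⟨VT_modEq, sum_modEq, card_modEq⟩ := hh
  have sum_eq := he.sum_f_add_sum_f_eq hk he' sum_modEq
  rw [he.parts_left, he'.parts_left] at card_modEq
  simp only [List.length_append] at card_modEq
  rw [he.fString_eq] at VT_modEq fString_lt
  rw [he'.fString_eq] at VT_modEq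
  simp only [List.map_append, ← List.append_assoc] at VT_modEq fString_lt
  have := he.length_pos_left
  have := he.length_pos_right
  have := he.length_le_left
  have := he.length_le_right
  have := he'.length_pos_left
  have := he'.length_pos_right
  have := he'.length_le_left
  have := he'.length_le_right
  have sum_M_lt := he.sum_f_lt hk
  have sum_M'_lt := he.symm.sum_f_lt hk
  have := length_le_of_VT_modEq (D := 2 * k * C k) (by simpa) (by simpa) (by simpa) (by simpa)
    (by simp only [List.length_map, abs_le]; omega) (by simp only [List.length_map]; omega)
    sum_eq (by rw [abs_lt]; omega)
    (fun card_eq sum_eq' => hne <| by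
      rw [List.length_map, List.length_map] at card_eq
      rw [he.eq_of_sum_f_eq hk card_eq sum_eq',
        he'.eq_of_sum_f_eq hk (by omega) (by omega)])
    (by simpa using fun r hr => two_mul_C_le_f (pattern_prefix r hr)) fString_lt VT_modEq
  rwa [List.length_map] at this

/-- The parts of `x` and `x'` agree except for two groups `G` and `G'` of consecutive parts, and the
number of parts in `G` is bounded in terms of the values of `f` on at most six of them. -/
def DifferInFewParts (k : ℕ) (x x' : List Bool) : Prop :=
  ∃ P G G' S E, parts k x = P ++ G ++ S ∧ parts k x' = P ++ G' ++ S ∧ E ⊆ G ∧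
    E.length ≤ 6 ∧ G.length ≤ 9 + 6 * (E.map (f k)).sum

lemma PartsEdit.differInFewParts (hk : 1 ≤ k) {P' S' : List (List Bool)} (hne : x ≠ x')
    (hlen : x.length = x'.length) (hh : h k x.length x = h k x.length x')
    (he : PartsEdit k x y P M M' S) (he' : PartsEdit k x' y P' N N' S')
    (hP : P.length ≤ P'.length) : DifferInFewParts k x x' := by
  have parts_eq : P ++ (M' ++ S) = P' ++ (N' ++ S') := by
    rw [← List.append_assoc, ← he.parts_right, he'.parts_right, List.append_assoc]
  obtain ⟨H, rfl⟩ : P <+: P' := List.prefix_of_prefix_length_le ⟨_, parts_eq⟩ ⟨_, rfl⟩ hP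
  rw [List.append_assoc, List.append_cancel_left_eq] at parts_eq
  have := he.length_le_left
  have := he'.length_le_right
  rcases le_or_gt M'.length H.length with hle | hlt
  · obtain ⟨R, rfl⟩ : M' <+: H := List.prefix_of_prefix_length_le ⟨_, parts_eq⟩ ⟨_, rfl⟩ hle
    rw [List.append_assoc, List.append_cancel_left_eq, ← List.append_assoc] at parts_eq
    subst parts_eq
    rw [← List.append_assoc] at he'
    have length_le := he.length_le_of_h_eq hk hne hlen hh he'
    refine ⟨P, M ++ R ++ N', M' ++ R ++ N, S', M ++ N', ?_, ?_, ?_, ?_, ?_⟩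
    · simp only [he.parts_left, List.append_assoc]
    · simp only [he'.parts_left, List.append_assoc]
    · simp
    · rw [List.length_append]
      omega
    · simp only [List.length_append, List.map_append, List.sum_append]
      omega
  · rw [← List.append_assoc] at parts_eq
    have := he.length_le_right
    rcases List.append_eq_append_iff.1 parts_eq with ⟨T, hT, rfl⟩ | ⟨T, _, rfl⟩
    · have := congrArg List.length hT
      simp only [List.length_append] at this
      exact ⟨P, M ++ T, H ++ N, S', [], by simp [he.parts_left], by simp [he'.parts_left],
        by simp, by simp, by rw [List.length_append]; omega⟩
    · exact ⟨P, M, H ++ N ++ T, S, [], by simp [he.parts_left], by simp [he'.parts_left],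
        by simp, by simp, by omega⟩

end CommonDescendant

/-- The constant in the bound on the length of the window in which two codewords differ. -/
noncomputable def windowConst (k : ℕ) : ℝ := 9 + 36 * (2 ^ k + B k + C k)

lemma windowConst_pos (k : ℕ) : 0 < windowConst k := by
  rw [windowConst]
  positivity

lemma length_flatten_le {G : List (List Bool)} {δ : ℝ} (hG : ∀ q ∈ G, (q.length : ℝ) ≤ δ) :
    (G.flatten.length : ℝ) ≤ G.length * δ := by
  induction G with
  | nil => simp
  | cons q G ih =>
    have := hG q List.mem_cons_self
    have := ih fun r hr => hG r (List.mem_cons_of_mem q hr)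
    simp only [List.flatten_cons, List.length_append, List.length_cons, Nat.cast_add, Nat.cast_one]
    linarith

section Dense

variable {k : ℕ} {x x' : List Bool} {δ : ℝ}

lemma Dense.one_le (hx : Dense k δ x) (hne : x ≠ []) : 1 ≤ δ := by
  rw [← flatten_parts k x, Ne, List.flatten_eq_nil_iff] at hne
  push Not at hne
  obtain ⟨q, hq, q_ne_nil⟩ := hne
  have : (1 : ℝ) ≤ q.length := by exact_mod_cast List.length_pos_iff.2 q_ne_nil
  exact this.trans (hx q hq)

lemma DifferInFewParts.agreeOutside (hxx : DifferInFewParts k x x') (hx : Dense k δ x)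
    (hne : x ≠ []) (hlen : x.length = x'.length) {l : ℕ} (hl : windowConst k * δ ^ 2 ≤ l) :
    AgreeOutside l x x' := by
  obtain ⟨P, G, G', S, E, parts_x, parts_x', E_subset, E_le, G_le⟩ := hxx
  have one_le_δ := hx.one_le hne
  have eq_left : x = P.flatten ++ G.flatten ++ S.flatten := by
    rw [← flatten_parts k x, parts_x, List.flatten_append, List.flatten_append]
  have eq_right : x' = P.flatten ++ G'.flatten ++ S.flatten := by
    rw [← flatten_parts k x', parts_x', List.flatten_append, List.flatten_append]
  have length_eq : G.flatten.length = G'.flatten.length := by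
    rw [eq_left, eq_right] at hlen
    simpa using hlen
  have length_le : ∀ q ∈ G, (q.length : ℝ) ≤ δ := fun q hq => hx q (by simp [parts_x, hq])
  have sum_f_le : ((E.map (f k)).sum : ℝ) ≤ 6 * (2 ^ k + B k + C k) * δ := by
    have E_le' : (E.length : ℝ) ≤ 6 := by exact_mod_cast E_le
    have flatten_le : (E.flatten.length : ℝ) ≤ 6 * δ :=
      (length_flatten_le fun q hq => length_le q (E_subset hq)).trans (by gcongr)
    calc ((E.map (f k)).sum : ℝ)
        ≤ E.length * 2 ^ k + (B k + C k) * E.flatten.length := by exact_mod_cast sum_f_le E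
      _ ≤ 6 * (2 ^ k * δ) + (B k + C k) * (6 * δ) := by
          gcongr
          exact le_mul_of_one_le_right (by positivity) one_le_δ
      _ = 6 * (2 ^ k + B k + C k) * δ := by ring
  have card_le : (G.length : ℝ) ≤ windowConst k * δ := by
    have : (G.length : ℝ) ≤ 9 + 6 * (E.map (f k)).sum := by exact_mod_cast G_le
    rw [windowConst]
    linarith
  refine ⟨P.flatten, G.flatten, G'.flatten, S.flatten, eq_left, eq_right, length_eq, ?_⟩
  have : (G.flatten.length : ℝ) ≤ l :=
    calc (G.flatten.length : ℝ) ≤ G.length * δ := length_flatten_le length_le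
      _ ≤ windowConst k * δ * δ := by gcongr
      _ = windowConst k * δ ^ 2 := by ring
      _ ≤ l := hl
  exact_mod_cast this

lemma agreeOutside_of_h_eq (hk : 1 ≤ k) (hxx : Confusable k x x') (hx : Dense k δ x)
    (hx' : Dense k δ x') (hh : h k x.length x = h k x.length x') {l : ℕ}
    (hl : windowConst k * δ ^ 2 ≤ l) : AgreeOutside l x x' := by
  rcases eq_or_ne x x' with rfl | hne
  · exact ⟨x, [], [], [], by simp, by simp, rfl, l.zero_le⟩
  obtain ⟨hlen, y, hy, hy'⟩ := hxx
  have ne_nil : x ≠ [] ∧ x' ≠ [] := by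
    simp only [← List.length_pos_iff, ← hlen, and_self]
    contrapose! hne
    rw [List.eq_nil_of_length_eq_zero (l := x) (by omega),
      List.eq_nil_of_length_eq_zero (l := x') (by omega)]
  obtain ⟨P, M, M', S, he⟩ := exists_partsEdit hk hy
  obtain ⟨P', N, N', S', he'⟩ := exists_partsEdit hk hy'
  rcases le_total P.length P'.length with hle | hle
  · exact (he.differInFewParts hk hne hlen hh he' hle).agreeOutside hx ne_nil.1 hlen hl
  · exact ((he'.differInFewParts hk hne.symm hlen.symm (hlen ▸ hh.symm) he hle).agreeOutside hx'
      ne_nil.2 hlen.symm hl).symm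

end Dense

/-! ### Correctness of the code -/

section Confusable

variable {k : ℕ} {x y : List Bool}

lemma SubstringEdit.reverse (hxy : SubstringEdit k x y) : SubstringEdit k x.reverse y.reverse := by
  obtain ⟨a, u, v, b, hu, hv, rfl, rfl⟩ := hxy
  exact ⟨b.reverse, u.reverse, v.reverse, a.reverse, by simpa, by simpa, by simp, by simp⟩

lemma SubstringEdit.drop (hxy : SubstringEdit k x y) (i : ℕ) :
    SubstringEdit k (x.drop i) (y.drop i) := by
  obtain ⟨a, u, v, b, hu, hv, rfl, rfl⟩ := hxy
  rcases le_total i a.length with hi | hi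
  · exact ⟨a.drop i, u, v, b, hu, hv, by simp [List.drop_append_of_le_length, hi],
      by simp [List.drop_append_of_le_length, hi]⟩
  · obtain ⟨j, rfl⟩ := Nat.exists_eq_add_of_le hi
    rw [List.append_assoc, List.append_assoc, List.drop_length_add_append,
      List.drop_length_add_append]
    wlog huv : u.length ≤ v.length generalizing u v
    · exact (this v u hv hu (Nat.le_of_not_le huv)).symm
    refine ⟨[], u.drop j, v.drop j ++ (b.drop (j - v.length)).take (j - u.length - (j - v.length)),
      b.drop (j - u.length), ?_, ?_, ?_, ?_⟩
    · exact (List.drop_sublist j u).length_le.trans hu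
    · simp only [List.length_append, List.length_drop, List.length_take]
      omega
    · rw [List.drop_append, List.nil_append]
    · rw [List.drop_append, List.nil_append, List.append_assoc, List.append_cancel_left_eq]
      conv_lhs => rw [← List.take_append_drop (j - u.length - (j - v.length)) (b.drop _)]
      rw [List.drop_drop, Nat.add_sub_cancel' (by omega)]

lemma SubstringEdit.rdrop (hxy : SubstringEdit k x y) (i : ℕ) :
    SubstringEdit k (x.rdrop i) (y.rdrop i) := by
  rw [List.rdrop_eq_reverse_drop_reverse, List.rdrop_eq_reverse_drop_reverse]
  exact (hxy.reverse.drop i).reverse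

namespace Confusable

variable {x' : List Bool}

lemma drop (hx : Confusable k x x') (i : ℕ) : Confusable k (x.drop i) (x'.drop i) := by
  obtain ⟨hlen, y, hy, hy'⟩ := hx
  exact ⟨by simp [hlen], _, hy.drop i, hy'.drop i⟩

lemma take (hx : Confusable k x x') (i : ℕ) : Confusable k (x.take i) (x'.take i) := by
  obtain ⟨hlen, y, hy, hy'⟩ := hx
  have take_eq (z : List Bool) : z.take i = z.rdrop (z.length - i) := by
    rw [List.rdrop, Nat.sub_sub_eq_min, Nat.min_comm, ← List.take_eq_take_min]
  refine ⟨by simp [hlen], y.rdrop (x.length - i), ?_, ?_⟩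
  · exact take_eq x ▸ hy.rdrop _
  · exact take_eq x' ▸ hlen ▸ hy'.rdrop _

lemma append (hx : Confusable k x x') (z : List Bool) : Confusable k (x ++ z) (x' ++ z) := by
  obtain ⟨hlen, y, hy, hy'⟩ := hx
  exact ⟨by simp [hlen], y ++ z, hy.append_append [] z, hy'.append_append [] z⟩

lemma block (hx : Confusable k x x') (A i : ℕ) : Confusable k (block A x i) (block A x' i) := by
  have hwindow := (hx.drop (i * A)).take A
  rw [EditCode.block, EditCode.block, List.rightpad, List.rightpad, hwindow.1]
  exact hwindow.append _

end Confusable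

end Confusable

section Blocks

variable {A : ℕ} {x x' : List Bool}

lemma length_block (A : ℕ) (x : List Bool) (i : ℕ) : (block A x i).length = A := by
  simp [block, List.rightpad]

lemma bits_block (x : List Bool) (i : ℕ) {j : ℕ} (hj : j < A) :
    bits (block A x i) j = bits x (i * A + j) := by
  have bits_rightpad (z : List Bool) : bits (z.rightpad A false) j = bits z j := by
    rw [List.rightpad]
    rcases lt_or_ge j z.length with hlt | hge
    · rw [bits_append_left hlt]
    · rw [bits_append_right hge, bits_of_length_le hge]
      simp [bits]
  rw [block, bits_rightpad]
  simp [bits, hj]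

lemma eq_of_forall_block_eq (hA : 1 ≤ A) (hlen : x.length = x'.length)
    (hblock : ∀ i < numBlocks A x, block A x i = block A x' i) : x = x' := by
  refine eq_of_bits_eq hlen fun e he => ?_
  have div_lt : e / A < numBlocks A x := by
    rw [numBlocks, Nat.div_lt_iff_lt_mul hA]
    have := Nat.div_add_mod' (x.length + A - 1) A
    have := Nat.mod_lt (x.length + A - 1) hA
    omega
  rw [← Nat.div_add_mod' e A, ← bits_block x _ (Nat.mod_lt e hA), hblock _ div_lt,
    bits_block x' _ (Nat.mod_lt e hA)]

lemma AgreeOutside.exists_forall_block_eq (hA : 1 ≤ A) (hx : AgreeOutside A x x') :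
    ∃ i₀, ∀ i, i ≠ i₀ → i ≠ i₀ + 1 → block A x i = block A x' i := by
  obtain ⟨a, w, w', b, rfl, rfl, hw, hwA⟩ := hx
  refine ⟨a.length / A, fun i hi hi' => ?_⟩
  refine eq_of_bits_eq (by rw [length_block, length_block]) fun e he => ?_
  rw [length_block] at he
  rw [bits_block _ _ he, bits_block _ _ he]
  refine bits_eq_of_outside hw ?_
  rcases lt_or_gt_of_ne hi with hlt | hgt
  · left
    have := Nat.mul_le_mul_right A (Nat.succ_le_of_lt hlt)
    have := Nat.div_mul_le_self a.length A
    rw [Nat.succ_mul] at *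
    omega
  · right
    have := Nat.mul_le_mul_right A (show a.length / A + 1 + 1 ≤ i by omega)
    have := Nat.lt_mul_div_succ a.length hA
    rw [add_mul _ 1 A] at *
    linarith

lemma eq_of_sum_modEq {s : Finset ℕ} {g g' : ℕ → ℕ} {Q j : ℕ} (hj : j ∈ s)
    (hne : ∀ i ∈ s, i ≠ j → g i = g' i) (hsum : ∑ i ∈ s, g i ≡ ∑ i ∈ s, g' i [MOD Q])
    (hg : g j < Q) (hg' : g' j < Q) : g j = g' j := by
  rw [← Finset.add_sum_erase _ _ hj, ← Finset.add_sum_erase _ _ hj,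
    Finset.sum_congr rfl fun i hi => hne i (Finset.mem_of_mem_erase hi)
      (Finset.ne_of_mem_erase hi)] at hsum
  exact (Nat.ModEq.add_right_cancel' _ hsum).eq_of_lt_of_lt hg hg'

end Blocks

section Psi

variable {k A : ℕ} {x x' : List Bool} {m : ℕ → ℕ} {φ : ℕ → List Bool → ℕ}

lemma IsEditHash.hash_block_eq (hφ : IsEditHash k m φ) {i₀ : ℕ}
    (hblock : ∀ i, i ≠ i₀ → i ≠ i₀ + 1 → block A x i = block A x' i) {s : Finset ℕ}
    (hs : ∀ i ∈ s, i + 1 ∉ s)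
    (hsum : ∑ i ∈ s, φ A (block A x i) ≡ ∑ i ∈ s, φ A (block A x' i) [MOD 2 ^ m A]) {i : ℕ}
    (hi : i ∈ s) : φ A (block A x i) = φ A (block A x' i) := by
  by_cases hfar : i ≠ i₀ ∧ i ≠ i₀ + 1
  · rw [hblock i hfar.1 hfar.2]
  · refine eq_of_sum_modEq (g := fun i => φ A (block A x i)) (g' := fun i => φ A (block A x' i)) hi
      (fun j hj hne => congrArg (φ A) (hblock j ?_ ?_)) hsum
      (hφ.lt_two_pow A _ (length_block A x i)) (hφ.lt_two_pow A _ (length_block A x' i))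
    · rintro rfl
      exact hs j hj ((show i = j + 1 by omega) ▸ hi)
    · rintro rfl
      exact hs i hi ((show i = i₀ by omega) ▸ hj)

/-- Two neighbouring blocks contribute to different components of `psi`. -/
lemma eq_of_psi_eq (hφ : IsEditHash k m φ) (hxx : Confusable k x x') (hA : AgreeOutside A x x')
    (hψ : psi m φ A x = psi m φ A x') : x = x' := by
  rcases A.eq_zero_or_pos with rfl | A_pos
  · obtain ⟨a, w, w', b, rfl, rfl, hw, hw_le⟩ := hA
    rw [List.eq_nil_of_length_eq_zero (l := w) (by omega),
      List.eq_nil_of_length_eq_zero (l := w') (by omega)]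
  obtain ⟨i₀, hblock⟩ := hA.exists_forall_block_eq A_pos
  have numBlocks_eq : numBlocks A x' = numBlocks A x := by rw [numBlocks, numBlocks, hxx.1]
  simp only [psi, Prod.mk.injEq, numBlocks_eq] at hψ
  refine eq_of_forall_block_eq A_pos hxx.1 fun i hi => ?_
  obtain ⟨y, hy, hy'⟩ := (hxx.block A i).2
  refine hφ.corrects A _ _ y (length_block A x i) (length_block A x' i) hy hy' ?_
  rcases Nat.even_or_odd (i + 1) with hpar | hpar
  · refine hφ.hash_block_eq hblock (fun j hj => ?_) hψ.2 (by simp [hi, hpar])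
    simp_all [parity_simps]
  · refine hφ.hash_block_eq hblock (fun j hj => ?_) hψ.1 (by simp [hi, hpar])
    simp_all [parity_simps]

theorem corrects_code (hk : 1 ≤ k) (hφ : IsEditHash k m φ) (n : ℕ) (δ : ℝ) (A : ℕ)
    (c₁ : ℕ × ℕ × ℕ) (c₂ : ℕ × ℕ) (hA : windowConst k * δ ^ 2 ≤ (A : ℝ)) :
    Corrects k (code k n δ m φ A c₁ c₂) := by
  rintro x ⟨rfl, hx, hh, hψ⟩ x' ⟨hlen, hx', hh', hψ'⟩ y hxy hxy'
  have hxx : Confusable k x x' := ⟨hlen.symm, y, hxy, hxy'⟩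
  exact eq_of_psi_eq hφ hxx (agreeOutside_of_h_eq hk hxx hx hx' (hh.trans hh'.symm) hA)
    (hψ.trans hψ'.symm)

end Psi

/-! ### Existence of the hashes -/

/-- The strings of length `n`. -/
def strings (n : ℕ) : Finset (List Bool) :=
  (Finset.univ : Finset (List.Vector Bool n)).map ⟨List.Vector.toList, List.Vector.toList_injective⟩

lemma mem_strings {n : ℕ} {x : List Bool} : x ∈ strings n ↔ x.length = n := by
  simp only [strings, Finset.mem_map, Finset.mem_univ, true_and, Function.Embedding.coeFn_mk]
  exact ⟨fun ⟨r, hr⟩ => hr ▸ r.toList_length, fun hx => ⟨⟨x, hx⟩, rfl⟩⟩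

lemma card_strings (n : ℕ) : (strings n).card = 2 ^ n := by
  rw [strings, Finset.card_map, Finset.card_univ, card_vector, Fintype.card_bool]

/-- The strings of length at most `k`, the possible insertions in an edit. -/
def shortStrings (k : ℕ) : Finset (List Bool) :=
  (Finset.range (k + 1)).biUnion strings

lemma mem_shortStrings {k : ℕ} {x : List Bool} : x ∈ shortStrings k ↔ x.length ≤ k := by
  simp [shortStrings, mem_strings]

/-- The strings that arise from `x` by replacing, at a position at most `l`, a substring of length
at most `k` by a string of length at most `k`. -/
def descendants (k l : ℕ) (x : List Bool) : Finset (List Bool) :=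
  ((Finset.range (l + 1) ×ˢ Finset.range (k + 1)) ×ˢ shortStrings k).image
    fun p => x.take p.1.1 ++ p.2 ++ x.drop (p.1.1 + p.1.2)

lemma mem_descendants {k l : ℕ} {x y : List Bool} (hl : x.length ≤ l)
    (hxy : SubstringEdit k x y) : y ∈ descendants k l x := by
  obtain ⟨a, u, v, b, hu, hv, rfl, rfl⟩ := hxy
  simp only [List.length_append] at hl
  simp only [descendants, Finset.mem_image, Finset.mem_product, Finset.mem_range, mem_shortStrings]
  refine ⟨((a.length, u.length), v), ⟨⟨?_, ?_⟩, hv⟩, by simp⟩ <;> dsimp only <;> omega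

lemma card_descendants_le (k l : ℕ) (x : List Bool) :
    (descendants k l x).card ≤ (l + 1) * (k + 1) * (shortStrings k).card := by
  refine Finset.card_image_le.trans_eq ?_
  simp only [Finset.card_product, Finset.card_range]

lemma colorable_of_degree_lt {V : Type*} [Fintype V] (G : SimpleGraph V) [DecidableRel G.Adj]
    {q : ℕ} (hq : ∀ v, G.degree v < q) : G.Colorable q := by
  classical
  suffices partial_coloring : ∀ T : Finset V,
      ∃ c : V → Fin q, ∀ v ∈ T, ∀ w ∈ T, G.Adj v w → c v ≠ c w by
    obtain ⟨c, hc⟩ := partial_coloring Finset.univ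
    exact ⟨SimpleGraph.Coloring.mk c fun {v w} => hc v (Finset.mem_univ v) w (Finset.mem_univ w)⟩
  intro T
  induction T using Finset.induction_on with
  | empty => exact ⟨fun v => ⟨0, (hq v).pos⟩, by simp⟩
  | insert a T _ ih =>
    obtain ⟨c, hc⟩ := ih
    obtain ⟨i, _, hi⟩ : ∃ i ∈ Finset.univ, i ∉ (G.neighborFinset a).image c := by
      refine Finset.exists_mem_notMem_of_card_lt_card (Finset.card_image_le.trans_lt ?_)
      rw [G.card_neighborFinset_eq_degree, Finset.card_univ, Fintype.card_fin]
      exact hq a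
    have color_ne (w : V) (haw : G.Adj a w) : c w ≠ i := fun hwi =>
      hi (Finset.mem_image.2 ⟨w, (G.mem_neighborFinset a w).2 haw, hwi⟩)
    refine ⟨Function.update c a i, fun v hv w hw hvw => ?_⟩
    rw [Finset.mem_insert] at hv hw
    rcases eq_or_ne v a with rfl | hva
    · rw [Function.update_self, Function.update_of_ne hvw.ne']
      exact (color_ne w hvw).symm
    · rw [Function.update_of_ne hva]
      rcases eq_or_ne w a with rfl | hwa
      · rw [Function.update_self]
        exact color_ne v hvw.symm
      · rw [Function.update_of_ne hwa]
        exact hc v (hv.resolve_left hva) w (hw.resolve_left hwa) hvw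

/-- The graph on the strings of length `A` in which distinct confusable strings are adjacent: its
colourings are the hashes that correct one edit. -/
def confusionGraph (k A : ℕ) : SimpleGraph (List.Vector Bool A) where
  Adj r r' := r ≠ r' ∧ Confusable k r.toList r'.toList
  symm := ⟨fun _ _ ⟨hne, hlen, s, hr, hr'⟩ => ⟨hne.symm, hlen.symm, s, hr', hr⟩⟩

/-- The constant of the degree bound of `confusionGraph`, which is quadratic in the length `A`: a
string has `O(A)` descendants, each of which in turn has `O(A)` ancestors. -/
def hashConst (k : ℕ) : ℕ := (k + 1) ^ 3 * (shortStrings k).card ^ 2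

open Classical in
lemma degree_confusionGraph_le (k A : ℕ) (r : List.Vector Bool A) :
    (confusionGraph k A).degree r ≤ (A + 1) ^ 2 * hashConst k := by
  have neighbors_subset :
      ((confusionGraph k A).neighborFinset r).image List.Vector.toList ⊆
        (descendants k A r.toList).biUnion (descendants k (A + k)) := by
    intro x hx
    obtain ⟨r', hr', rfl⟩ := Finset.mem_image.1 hx
    obtain ⟨_, _, s, hrs, hrs'⟩ := ((confusionGraph k A).mem_neighborFinset r r').1 hr'
    have s_length_le : s.length ≤ A + k := r.toList_length ▸ hrs.symm.length_le
    exact Finset.mem_biUnion.2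
      ⟨s, mem_descendants r.toList_length.le hrs, mem_descendants s_length_le hrs'.symm⟩
  have add_le : A + k + 1 ≤ (A + 1) * (k + 1) := by linarith [Nat.zero_le (A * k)]
  calc (confusionGraph k A).degree r
      ≤ ((descendants k A r.toList).biUnion (descendants k (A + k))).card := by
        rw [← SimpleGraph.card_neighborFinset_eq_degree,
          ← Finset.card_image_of_injective _ List.Vector.toList_injective]
        exact Finset.card_le_card neighbors_subset
    _ ≤ (A + 1) * (k + 1) * (shortStrings k).card *
          ((A + k + 1) * (k + 1) * (shortStrings k).card) :=
        (Finset.card_biUnion_le_card_mul _ _ _ fun s _ => card_descendants_le k (A + k) s).trans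
          (Nat.mul_le_mul_right _ (card_descendants_le k A r.toList))
    _ ≤ (A + 1) * (k + 1) * (shortStrings k).card *
          ((A + 1) * (k + 1) * (k + 1) * (shortStrings k).card) := by gcongr
    _ = (A + 1) ^ 2 * hashConst k := by rw [hashConst]; ring

lemma sq_mul_lt_two_pow (A c : ℕ) : (A + 1) ^ 2 * c < 2 ^ (2 * Nat.log 2 A + 4 * c) := by
  have succ_le : A + 1 ≤ 2 ^ (Nat.log 2 A + 1) := Nat.lt_pow_succ_log_self (by norm_num) A
  calc (A + 1) ^ 2 * c ≤ (2 ^ (Nat.log 2 A + 1)) ^ 2 * c := by gcongr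
    _ = 2 ^ (2 * Nat.log 2 A) * (4 * c) := by ring
    _ < 2 ^ (2 * Nat.log 2 A) * 2 ^ (4 * c) :=
      Nat.mul_lt_mul_of_pos_left Nat.lt_two_pow_self (by positivity)
    _ = 2 ^ (2 * Nat.log 2 A + 4 * c) := (pow_add _ _ _).symm

lemma tendsto_logb_two_natCast : Tendsto (fun n : ℕ => Real.logb 2 (n : ℝ)) atTop atTop :=
  (Real.tendsto_logb_atTop (by norm_num)).comp tendsto_natCast_atTop_atTop

theorem exists_isEditHash {k : ℕ} (hk : 1 ≤ k) :
    ∃ (m : ℕ → ℕ) (φ : ℕ → List Bool → ℕ), IsEditHash k m φ := by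
  classical
  let m (A : ℕ) : ℕ := 2 * Nat.log 2 A + 4 * hashConst k
  have colorable (A : ℕ) : (confusionGraph k A).Colorable (2 ^ m A) :=
    colorable_of_degree_lt _ fun r =>
      (degree_confusionGraph_le k A r).trans_lt (sq_mul_lt_two_pow A (hashConst k))
  let c (A : ℕ) : (confusionGraph k A).Coloring (Fin (2 ^ m A)) := (colorable A).some
  let φ (A : ℕ) (r : List Bool) : ℕ := if hr : r.length = A then c A ⟨r, hr⟩ else 0
  refine ⟨m, φ, ⟨fun A r hr => ?_, fun A r r' s hr hr' hrs hrs' heq => ?_,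
    fun _ => ((4 * hashConst k : ℕ) : ℝ), ?_, fun A => ?_⟩⟩
  · simp only [φ, hr, dite_true, Fin.is_lt]
  · by_contra hne
    simp only [φ, hr, hr', dite_true] at heq
    exact (c A).valid (v := ⟨r, hr⟩) (w := ⟨r', hr'⟩)
      ⟨fun h => hne (congrArg List.Vector.toList h), hr.trans hr'.symm, s, hrs, hrs'⟩ (Fin.ext heq)
  · exact isLittleO_const_left.2
      (Or.inr (tendsto_norm_atTop_atTop.comp tendsto_logb_two_natCast))
  · have log_le : (Nat.log 2 A : ℝ) ≤ Real.logb 2 A := by exact_mod_cast Real.natLog_le_logb A 2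
    have : (0 : ℝ) ≤ Nat.log 2 A := Nat.cast_nonneg _
    have one_le_k : (1 : ℝ) ≤ k := by exact_mod_cast hk
    simp only [m]
    push_cast
    nlinarith

/-! ### Counting the dense strings -/

section Counting

variable {k n L T : ℕ} {w : List Bool}

lemma occ_parts_head {t q : List Bool} {S : List (List Bool)} (ht : parts k t = q :: S) :
    occ (pattern k) q = 0 := by
  induction t generalizing q S with
  | nil =>
    obtain ⟨rfl, -⟩ := List.cons.inj ht
    rfl
  | cons c t ih =>
    obtain ⟨r, R, hr⟩ := exists_parts_eq_cons k t
    have t_eq := flatten_parts k t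
    rw [hr, List.flatten_cons] at t_eq
    rw [parts_cons, hr] at ht
    split_ifs at ht with starts
    · obtain ⟨rfl, -⟩ := List.cons.inj ht
      rfl
    · obtain ⟨rfl, -⟩ := List.cons.inj ht
      have : ¬ pattern k <+: c :: r := fun hp =>
        starts (hp.trans ⟨R.flatten, by rw [List.cons_append, t_eq]⟩)
      rw [occ_cons, if_neg this, ih hr]

lemma occ_tail_of_mem_parts {x q : List Bool} (hq : q ∈ parts k x) :
    occ (pattern k) q.tail = 0 := by
  induction x generalizing q with
  | nil =>
    obtain rfl := List.mem_singleton.1 hq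
    rfl
  | cons c t ih =>
    obtain ⟨r, R, hr⟩ := exists_parts_eq_cons k t
    rw [parts_cons, hr, List.mem_append, List.modifyHead_cons, List.mem_cons] at hq
    rcases hq with hq | rfl | hq
    · split_ifs at hq
      · obtain rfl := List.mem_singleton.1 hq
        rfl
      · exact absurd hq List.not_mem_nil
    · exact occ_parts_head hr
    · exact ih (hr ▸ List.mem_cons_of_mem _ hq)

/-- The strings that consist of `T` blocks of the length of `w`, none of which is `w`. -/
def avoiding (w : List Bool) : ℕ → Finset (List Bool)
  | 0 => {[]}
  | T + 1 => Finset.image₂ (· ++ ·) ((strings w.length).erase w) (avoiding w T)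

lemma card_avoiding_le (w : List Bool) (T : ℕ) :
    (avoiding w T).card ≤ (2 ^ w.length - 1) ^ T := by
  induction T with
  | zero => exact (Finset.card_singleton _).le
  | succ T ih =>
    refine (Finset.card_image₂_le _ _ _).trans ?_
    rw [Finset.card_erase_of_mem (mem_strings.2 rfl), card_strings, pow_succ']
    exact Nat.mul_le_mul_left _ ih

lemma mem_avoiding (hw : w ≠ []) {z : List Bool} (hz : z.length = w.length * T)
    (hocc : occ w z = 0) : z ∈ avoiding w T := by
  induction T generalizing z with
  | zero => simpa [avoiding] using hz
  | succ T ih =>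
    rw [mul_add, mul_one] at hz
    obtain ⟨c, v, rfl⟩ := List.exists_cons_of_ne_nil hw
    have split := occ_append (c :: v) (z.take (c :: v).length) (z.drop (c :: v).length)
    rw [List.take_append_drop, hocc] at split
    refine Finset.mem_image₂.2 ⟨_, Finset.mem_erase.2 ⟨fun heq => ?_, ?_⟩, _, ih ?_ (by omega),
      List.take_append_drop (c :: v).length z⟩
    · have : occ (c :: v) (c :: v) = 1 + occ (c :: v) v := by
        rw [occ_cons, if_pos List.prefix_rfl]
      rw [heq] at split
      omega
    · rw [mem_strings, List.length_take]
      omega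
    · rw [List.length_drop]
      omega

lemma card_filter_window_le (Z : Finset (List Bool)) {i : ℕ} (hi : i + L ≤ n) :
    ((strings n).filter fun x => (x.drop i).take L ∈ Z).card * 2 ^ L ≤ 2 ^ n * Z.card := by
  have covered : (strings n).filter (fun x => (x.drop i).take L ∈ Z) ⊆
      ((strings i ×ˢ Z) ×ˢ strings (n - i - L)).image fun p => p.1.1 ++ p.1.2 ++ p.2 := by
    intro x hx
    obtain ⟨hxn, hxZ⟩ := Finset.mem_filter.1 hx
    have hxn := mem_strings.1 hxn
    refine Finset.mem_image.2
      ⟨((x.take i, (x.drop i).take L), (x.drop i).drop L), ?_, by simp⟩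
    simp only [Finset.mem_product, mem_strings, List.length_take, List.length_drop, hxn]
    exact ⟨⟨by omega, hxZ⟩, trivial⟩
  calc _ ≤ 2 ^ i * Z.card * 2 ^ (n - i - L) * 2 ^ L := by
        refine Nat.mul_le_mul_right _ ((Finset.card_le_card covered).trans ?_)
        refine Finset.card_image_le.trans_eq ?_
        simp only [Finset.card_product, card_strings]
    _ = 2 ^ (i + (n - i - L) + L) * Z.card := by ring
    _ = 2 ^ n * Z.card := by rw [show i + (n - i - L) + L = n by omega]

lemma card_filter_exists_window_le (Z : Finset (List Bool)) {I : Finset ℕ}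
    (hI : ∀ i ∈ I, i + L ≤ n) :
    ((strings n).filter fun x => ∃ i ∈ I, (x.drop i).take L ∈ Z).card * 2 ^ L ≤
      I.card * (2 ^ n * Z.card) := by
  have covered : (strings n).filter (fun x => ∃ i ∈ I, (x.drop i).take L ∈ Z) ⊆
      I.biUnion fun i => (strings n).filter fun x => (x.drop i).take L ∈ Z := by
    intro x hx
    obtain ⟨hxn, i, hi, hiZ⟩ := Finset.mem_filter.1 hx
    exact Finset.mem_biUnion.2 ⟨i, hi, Finset.mem_filter.2 ⟨hxn, hiZ⟩⟩
  calc _ ≤ (∑ i ∈ I, ((strings n).filter fun x => (x.drop i).take L ∈ Z).card) * 2 ^ L :=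
        Nat.mul_le_mul_right _ ((Finset.card_le_card covered).trans Finset.card_biUnion_le)
    _ ≤ I.card * (2 ^ n * Z.card) := by
        rw [Finset.sum_mul]
        exact Finset.sum_le_card_nsmul I _ _ fun i hi => card_filter_window_le Z (hI i hi)

/-- The window starts at the second bit of a long part, because the part itself may start with the
pattern. -/
lemma exists_window_mem_avoiding (hk : 1 ≤ k) {δ : ℝ} (hT : (2 * k * T : ℝ) ≤ δ) {x : List Bool}
    (hx : ¬ Dense k δ x) :
    ∃ i ∈ Finset.Icc 1 (x.length - 2 * k * T),
      (x.drop i).take (2 * k * T) ∈ avoiding (pattern k) T := by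
  obtain ⟨q, hq, hqδ⟩ : ∃ q ∈ parts k x, δ < q.length := by simpa [Dense] using hx
  have long : 2 * k * T < q.length := by exact_mod_cast hT.trans_lt hqδ
  obtain ⟨c, q, rfl⟩ := List.exists_cons_of_length_pos ((Nat.zero_le _).trans_lt long)
  have occ_q : occ (pattern k) q = 0 := occ_tail_of_mem_parts hq
  obtain ⟨P, S, hPS⟩ := List.append_of_mem hq
  have x_eq : x = (P.flatten ++ [c]) ++ (q ++ S.flatten) := by
    rw [← flatten_parts k x, hPS]
    simp
  have pattern_ne_nil : pattern k ≠ [] :=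
    List.ne_nil_of_length_pos (by rw [length_pattern]; omega)
  have split := occ_append (pattern k) (q.take (2 * k * T)) (q.drop (2 * k * T))
  rw [List.take_append_drop, occ_q] at split
  rw [List.length_cons] at long
  refine ⟨(P.flatten ++ [c]).length, ?_, ?_⟩
  · rw [Finset.mem_Icc, x_eq]
    simp only [List.length_append, List.length_singleton]
    omega
  · rw [x_eq, List.drop_left, List.take_append_of_le_length (by omega)]
    refine mem_avoiding pattern_ne_nil ?_ (by omega)
    rw [length_pattern, List.length_take]
    omega

open Classical in
lemma card_filter_not_dense_le (hk : 1 ≤ k) (n : ℕ) {δ : ℝ} (hT : (2 * k * T : ℝ) ≤ δ) :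
    ((strings n).filter fun x => ¬ Dense k δ x).card * 2 ^ (2 * k * T) ≤
      n * (2 ^ n * (2 ^ (2 * k) - 1) ^ T) := by
  rcases lt_or_ge n (2 * k * T) with hlt | hle
  · have : (strings n).filter (fun x => ¬ Dense k δ x) = ∅ := by
      refine Finset.filter_eq_empty_iff.2 fun x hx hdense => ?_
      obtain ⟨i, hi, _⟩ := exists_window_mem_avoiding hk hT hdense
      rw [mem_strings.1 hx, Finset.mem_Icc] at hi
      omega
    simp [this]
  have covered : (strings n).filter (fun x => ¬ Dense k δ x) ⊆
      (strings n).filter fun x => ∃ i ∈ Finset.Icc 1 (n - 2 * k * T),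
        (x.drop i).take (2 * k * T) ∈ avoiding (pattern k) T := by
    intro x hx
    obtain ⟨hxn, hdense⟩ := Finset.mem_filter.1 hx
    refine Finset.mem_filter.2 ⟨hxn, ?_⟩
    rw [← mem_strings.1 hxn]
    exact exists_window_mem_avoiding hk hT hdense
  have avoiding_le := card_avoiding_le (pattern k) T
  rw [length_pattern] at avoiding_le
  have positions_le : (Finset.Icc 1 (n - 2 * k * T)).card ≤ n := by
    rw [Nat.card_Icc, Nat.add_sub_cancel]
    exact Nat.sub_le _ _
  have inside : ∀ i ∈ Finset.Icc 1 (n - 2 * k * T), i + 2 * k * T ≤ n := fun i hi => by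
    have := (Finset.mem_Icc.1 hi).2
    omega
  exact (Nat.mul_le_mul_right _ (Finset.card_le_card covered)).trans
    ((card_filter_exists_window_le _ inside).trans
      (Nat.mul_le_mul positions_le (Nat.mul_le_mul_left _ avoiding_le)))

lemma sub_one_pow_le {a : ℝ} (ha : 1 ≤ a) (T : ℕ) :
    (a - 1) ^ T ≤ a ^ T * Real.exp (-(T / a)) := by
  have : 0 < a := by linarith
  have base : a - 1 ≤ a * Real.exp (-(1 / a)) :=
    calc a - 1 = a * (-(1 / a) + 1) := by field_simp; ring
      _ ≤ a * Real.exp (-(1 / a)) := by gcongr; exact Real.add_one_le_exp _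
  calc (a - 1) ^ T ≤ (a * Real.exp (-(1 / a))) ^ T := pow_le_pow_left₀ (by linarith) base T
    _ = a ^ T * Real.exp (-(T / a)) := by
        rw [mul_pow, ← Real.exp_nat_mul]
        congr 2
        ring

lemma mul_exp_neg_le_half {y t : ℝ} (hy : 2 ≤ y) (ht : 4 * Real.log y - 1 ≤ t) :
    y * Real.exp (-t) ≤ 1 / 2 := by
  have y_pos : 0 < y := by linarith
  have eight_le : (2 : ℝ) ^ 3 ≤ y ^ 3 := pow_le_pow_left₀ (by norm_num) hy 3
  have := Real.exp_one_lt_d9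
  calc y * Real.exp (-t) ≤ y * Real.exp (1 - (4 : ℕ) * Real.log y) := by
        gcongr
        push_cast
        linarith
    _ = Real.exp 1 / y ^ 3 := by
        rw [Real.exp_sub, Real.exp_nat_mul, Real.exp_log y_pos]
        field_simp
    _ ≤ 1 / 2 := by
        rw [div_le_div_iff₀ (by positivity) (by norm_num)]
        linarith

open Classical in
lemma two_mul_card_filter_not_dense_le (hk : 1 ≤ k) (hn : 2 ≤ n) :
    2 * ((strings n).filter fun x => ¬ Dense k (delta k n) x).card ≤ 2 ^ n := by
  have two_le : (2 : ℝ) ≤ n := by exact_mod_cast hn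
  have log_nonneg : 0 ≤ Real.log n := Real.log_nonneg (by linarith)
  have log_le : Real.log n ≤ Real.logb 2 n :=
    le_div_self log_nonneg (Real.log_pos (by norm_num)) (by linarith [Real.log_two_lt_d9])
  let a : ℝ := 2 ^ (2 * k)
  have one_le_a : 1 ≤ a := one_le_pow₀ (by norm_num)
  have arg_nonneg : 0 ≤ 4 * a * Real.logb 2 n := by have := log_nonneg.trans log_le; positivity
  let T := ⌊4 * a * Real.logb 2 n⌋₊
  have T_le : (2 * k * T : ℝ) ≤ delta k n :=
    calc (2 * k * T : ℝ) ≤ 2 * k * (4 * a * Real.logb 2 n) := by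
          gcongr
          exact Nat.floor_le arg_nonneg
      _ = delta k n := by rw [delta, pow_add]; ring
  have le_T_div : 4 * Real.log n - 1 ≤ T / a := by
    have := Nat.lt_floor_add_one (4 * a * Real.logb 2 n)
    have : 4 * a * Real.log n ≤ 4 * a * Real.logb 2 n := by gcongr
    rw [le_div_iff₀ (by linarith)]
    linarith
  set N := ((strings n).filter fun x => ¬ Dense k (delta k n) x).card
  have count : (N : ℝ) * a ^ T ≤ n * (2 ^ n * (a - 1) ^ T) := by
    have := card_filter_not_dense_le hk n T_le
    rw [pow_mul] at this
    have cast_eq : ((2 ^ (2 * k) - 1 : ℕ) : ℝ) = a - 1 := by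
      rw [Nat.cast_sub Nat.one_le_two_pow]
      simp [a]
    rw [← cast_eq]
    simp only [a]
    exact_mod_cast this
  have scaled : (N : ℝ) * a ^ T ≤ 2 ^ n / 2 * a ^ T :=
    calc (N : ℝ) * a ^ T ≤ n * (2 ^ n * (a ^ T * Real.exp (-(T / a)))) :=
          count.trans (by gcongr; exact sub_one_pow_le one_le_a T)
      _ = 2 ^ n * (n * Real.exp (-(T / a))) * a ^ T := by ring
      _ ≤ 2 ^ n * (1 / 2) * a ^ T := by gcongr; exact mul_exp_neg_le_half two_le le_T_div
      _ = 2 ^ n / 2 * a ^ T := by ring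
  have := le_of_mul_le_mul_right scaled (by positivity)
  have : (2 * N : ℝ) ≤ 2 ^ n := by linarith
  exact_mod_cast this

end Counting

/-! ### Large codes -/

section LargeCode

variable {k n : ℕ}

/-- The possible values of the pair of hashes `h` and `psi`. -/
def hashValues (k n : ℕ) (m : ℕ → ℕ) (A : ℕ) : Finset ((ℕ × ℕ × ℕ) × ℕ × ℕ) :=
  (Finset.range (2000 * C k * n) ×ˢ Finset.range (10 * C k * k) ×ˢ Finset.range 5) ×ˢ
    Finset.range (2 ^ m A) ×ˢ Finset.range (2 ^ m A)

lemma C_pos (hk : 1 ≤ k) : 0 < C k := by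
  rw [C]
  positivity

lemma mem_hashValues (hk : 1 ≤ k) (hn : n ≠ 0) (m : ℕ → ℕ) (φ : ℕ → List Bool → ℕ) (A : ℕ)
    (x : List Bool) : (h k n x, psi m φ A x) ∈ hashValues k n m A := by
  have := C_pos hk
  simp only [hashValues, h, psi, Finset.mem_product, Finset.mem_range]
  exact ⟨⟨Nat.mod_lt _ (by positivity), Nat.mod_lt _ (by positivity), Nat.mod_lt _ (by norm_num)⟩,
    Nat.mod_lt _ (by positivity), Nat.mod_lt _ (by positivity)⟩

lemma card_hashValues (k n : ℕ) (m : ℕ → ℕ) (A : ℕ) :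
    (hashValues k n m A).card = 100000 * C k ^ 2 * k * n * (2 ^ m A) ^ 2 := by
  simp only [hashValues, Finset.card_product, Finset.card_range]
  ring

lemma finite_of_forall_length_eq {D : Set (List Bool)} (hD : ∀ x ∈ D, x.length = n) : D.Finite :=
  (strings n).finite_toSet.subset fun x hx => mem_strings.2 (hD x hx)

open Classical in
lemma exists_large_code (hk : 1 ≤ k) (hn : 2 ≤ n) (m : ℕ → ℕ) (φ : ℕ → List Bool → ℕ) (A : ℕ) :
    ∃ c₁ c₂, 2 ^ n ≤
      2 * (hashValues k n m A).card * (code k n (delta k n) m φ A c₁ c₂).ncard := by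
  let D := (strings n).filter fun x => Dense k (delta k n) x
  have two_pow_le : 2 ^ n ≤ 2 * D.card := by
    have sparse_le := two_mul_card_filter_not_dense_le hk hn
    have total := Finset.card_filter_add_card_filter_not (s := strings n)
      (fun x => Dense k (delta k n) x)
    rw [card_strings] at total
    simp only [D]
    omega
  have maps_to (x : List Bool) : (h k n x, psi m φ A x) ∈ hashValues k n m A :=
    mem_hashValues hk (by omega) m φ A x
  have values_pos : (0 : ℝ) < (hashValues k n m A).card := by
    exact_mod_cast Finset.card_pos.2 ⟨_, maps_to []⟩
  obtain ⟨⟨c₁, c₂⟩, _, average_le⟩ := Finset.exists_le_card_fiber_of_nsmul_le_card_of_maps_to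
    (fun x (_ : x ∈ D) => maps_to x) ⟨_, maps_to []⟩ (b := (D.card : ℝ) / (hashValues k n m A).card)
    (by rw [nsmul_eq_mul, mul_div_cancel₀ _ values_pos.ne'])
  refine ⟨c₁, c₂, two_pow_le.trans ?_⟩
  have fiber_subset : ((D.filter fun x => (h k n x, psi m φ A x) = (c₁, c₂) : Finset _) :
      Set (List Bool)) ⊆ code k n (delta k n) m φ A c₁ c₂ := by
    intro x hx
    simp only [D, Finset.mem_coe, Finset.mem_filter, mem_strings, Prod.mk.injEq] at hx
    exact ⟨hx.1.1, hx.1.2, hx.2.1, hx.2.2⟩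
  have fiber_le := Set.ncard_le_ncard fiber_subset
    (finite_of_forall_length_eq fun x (hx : x ∈ code _ _ _ _ _ _ _ _) => hx.1)
  rw [Set.ncard_coe_finset] at fiber_le
  rw [div_le_iff₀' values_pos] at average_le
  rw [mul_assoc]
  exact Nat.mul_le_mul_left 2 ((by exact_mod_cast average_le :
    D.card ≤ _ * _).trans (Nat.mul_le_mul_left _ fiber_le))

end LargeCode

/-! ### Redundancy -/

section Redundancy

variable {k n : ℕ} {D : Set (List Bool)}

lemma substringEdit_set (hk : 1 ≤ k) {x : List Bool} {i : ℕ} (hi : i < x.length) (c : Bool) :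
    SubstringEdit k x (x.set i c) := by
  refine ⟨x.take i, [x[i]], [c], x.drop (i + 1), hk, hk, by simp, ?_⟩
  rw [List.set_eq_take_append_cons_drop, if_pos hi, List.append_assoc, List.singleton_append]

lemma SubstringEdit.refl (k : ℕ) (x : List Bool) : SubstringEdit k x x :=
  ⟨x, [], [], [], Nat.zero_le k, Nat.zero_le k, by simp, by simp⟩

/-- The string `x` with its `i`-th bit flipped; for `i = x.length` this is `x` itself. -/
def flipBit (x : List Bool) (i : ℕ) : List Bool :=
  x.set i !bits x i

lemma substringEdit_flipBit (hk : 1 ≤ k) (x : List Bool) (i : ℕ) :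
    SubstringEdit k x (flipBit x i) := by
  rw [flipBit]
  rcases lt_or_ge i x.length with hi | hi
  · exact substringEdit_set hk hi _
  · rw [List.set_eq_of_length_le hi]
    exact SubstringEdit.refl k x

lemma bits_flipBit_self {x : List Bool} {i : ℕ} (hi : i < x.length) :
    bits (flipBit x i) i = !bits x i := by
  simp [flipBit, bits, List.getD, hi]

lemma bits_flipBit_of_ne (x : List Bool) {i j : ℕ} (hij : i ≠ j) :
    bits (flipBit x i) j = bits x j := by
  simp [flipBit, bits, List.getD, hij]

lemma flipBit_injOn (x : List Bool) : Set.InjOn (flipBit x) {i | i ≤ x.length} := by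
  intro i hi j hj heq
  by_contra hne
  wlog hij : i < j generalizing i j
  · exact this hj hi heq.symm (Ne.symm hne) ((Ne.lt_or_gt hne).resolve_left hij)
  have := bits_flipBit_self (hij.trans_le hj)
  rw [heq, bits_flipBit_of_ne x (Ne.symm hne)] at this
  exact Bool.not_ne_self _ this.symm

lemma ncard_mul_succ_le_of_corrects (hk : 1 ≤ k) (hD : ∀ x ∈ D, x.length = n)
    (hc : Corrects k D) : D.ncard * (n + 1) ≤ 2 ^ n := by
  have finite := finite_of_forall_length_eq hD
  rw [Set.ncard_eq_toFinset_card D finite, ← Finset.card_range (n + 1), ← Finset.card_product,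
    ← card_strings]
  refine Finset.card_le_card_of_injOn (fun p => flipBit p.1 p.2) ?_ ?_
  · rintro ⟨x, i⟩ hx
    simp only [Finset.coe_product, Set.mem_prod, Finset.mem_coe, Set.Finite.mem_toFinset] at hx
    simp [flipBit, mem_strings, hD x hx.1]
  · rintro ⟨x, i⟩ hx ⟨x', i'⟩ hx' heq
    simp only [Finset.coe_product, Set.mem_prod, Finset.mem_coe, Set.Finite.mem_toFinset,
      Finset.mem_range, Nat.lt_succ_iff] at hx hx' heq
    obtain rfl : x = x' := hc x hx.1 x' hx'.1 _ (substringEdit_flipBit hk x i)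
      (heq ▸ substringEdit_flipBit hk x' i')
    rw [flipBit_injOn x (by simpa [hD x hx.1] using hx.2) (by simpa [hD x hx.1] using hx'.2) heq]

lemma logb_succ_le_redundancy (hk : 1 ≤ k) (hne : D.Nonempty) (hD : ∀ x ∈ D, x.length = n)
    (hc : Corrects k D) : Real.logb 2 (n + 1) ≤ redundancy n D := by
  have ncard_pos : (0 : ℝ) < D.ncard := by
    exact_mod_cast (Set.ncard_pos (finite_of_forall_length_eq hD)).2 hne
  have packing : (D.ncard : ℝ) * (n + 1) ≤ 2 ^ n := by
    exact_mod_cast ncard_mul_succ_le_of_corrects hk hD hc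
  have := Real.logb_le_logb_of_le (b := 2) (by norm_num) (by positivity) packing
  rw [Real.logb_mul ncard_pos.ne' (by positivity), Real.logb_pow,
    Real.logb_self_eq_one (by norm_num)] at this
  rw [redundancy]
  linarith

lemma optRedundancy_le_redundancy (hk : 1 ≤ k) (hne : D.Nonempty) (hD : ∀ x ∈ D, x.length = n)
    (hc : Corrects k D) : optRedundancy k n ≤ redundancy n D := by
  refine csInf_le ⟨Real.logb 2 (n + 1), ?_⟩ ⟨D, hne, hD, hc, rfl⟩
  rintro _ ⟨E, hE, hEn, hEc, rfl⟩
  exact logb_succ_le_redundancy hk hE hEn hEc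

lemma logb_le_optRedundancy (hk : 1 ≤ k) (hn : n ≠ 0) :
    Real.logb 2 n ≤ optRedundancy k n := by
  refine le_csInf ⟨_, {List.replicate n false}, Set.singleton_nonempty _, ?_, ?_, rfl⟩ ?_
  · simp
  · rintro _ rfl _ rfl _ _ _
    rfl
  · rintro _ ⟨E, hE, hEn, hEc, rfl⟩
    refine le_trans ?_ (logb_succ_le_redundancy hk hE hEn hEc)
    exact Real.logb_le_logb_of_le (by norm_num) (by positivity) (by linarith)

lemma nonempty_of_two_pow_le_mul_ncard {N : ℕ} (hN : 2 ^ n ≤ N * D.ncard) : D.Nonempty :=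
  Set.nonempty_of_ncard_ne_zero fun h0 => by
    rw [h0, mul_zero] at hN
    exact hN.not_gt (Nat.two_pow_pos n)

lemma redundancy_le_logb {N : ℕ} (hN : 2 ^ n ≤ N * D.ncard) :
    redundancy n D ≤ Real.logb 2 N := by
  have pos : 0 < N * D.ncard := (Nat.two_pow_pos n).trans_le hN
  have ncard_ne : (D.ncard : ℝ) ≠ 0 := by exact_mod_cast (Nat.pos_of_mul_pos_left pos).ne'
  have N_ne : (N : ℝ) ≠ 0 := by exact_mod_cast (Nat.pos_of_mul_pos_right pos).ne'
  have hN' : (2 : ℝ) ^ n ≤ N * D.ncard := by exact_mod_cast hN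
  have := Real.logb_le_logb_of_le (b := 2) (by norm_num) (by positivity) hN'
  rw [Real.logb_mul N_ne ncard_ne, Real.logb_pow, Real.logb_self_eq_one (by norm_num)] at this
  rw [redundancy]
  linarith

lemma logb_two_mul_card_hashValues (hk : 1 ≤ k) (hn : n ≠ 0) (m : ℕ → ℕ) (A : ℕ) :
    Real.logb 2 ((2 * (hashValues k n m A).card : ℕ) : ℝ) =
      Real.logb 2 n + Real.logb 2 (200000 * C k ^ 2 * k) + 2 * m A := by
  have := C_pos hk
  have factor : ((2 * (hashValues k n m A).card : ℕ) : ℝ) =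
      n * (200000 * C k ^ 2 * k) * (2 ^ m A) ^ 2 := by
    rw [card_hashValues]
    push_cast
    ring
  rw [factor, Real.logb_mul (by positivity) (by positivity),
    Real.logb_mul (by positivity) (by positivity), Real.logb_pow, Real.logb_pow,
    Real.logb_self_eq_one (by norm_num)]
  push_cast
  ring

lemma exists_redundancy_code_le (hk : 1 ≤ k) (hn : 2 ≤ n) (m : ℕ → ℕ) (φ : ℕ → List Bool → ℕ)
    (A : ℕ) : ∃ c₁ c₂, (code k n (delta k n) m φ A c₁ c₂).Nonempty ∧
      redundancy n (code k n (delta k n) m φ A c₁ c₂) - Real.logb 2 n ≤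
        Real.logb 2 (200000 * C k ^ 2 * k) + 2 * m A := by
  obtain ⟨c₁, c₂, large⟩ := exists_large_code hk hn m φ A
  refine ⟨c₁, c₂, nonempty_of_two_pow_le_mul_ncard large, ?_⟩
  have := redundancy_le_logb large
  rw [logb_two_mul_card_hashValues hk (by omega)] at this
  linarith

end Redundancy

/-! ### Asymptotics -/

section Asymptotics

variable {ι : Type*} {l : Filter ι}

lemma isBigO_of_nonneg_of_le {u v : ι → ℝ} (hu : ∀ᶠ i in l, 0 ≤ u i) (huv : ∀ᶠ i in l, u i ≤ v i) :
    u =O[l] v := by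
  refine Filter.Eventually.isBigO ?_
  filter_upwards [hu, huv] with i hi hle
  rwa [Real.norm_of_nonneg hi]

lemma isBigO_logb_of_isBigO {u v : ι → ℝ} (hu : ∀ᶠ i in l, 1 ≤ u i) (hv : Tendsto v l atTop)
    (huv : u =O[l] v) : (fun i => Real.logb 2 (u i)) =O[l] fun i => Real.logb 2 (v i) := by
  obtain ⟨c, hc⟩ := huv.bound
  have log_isBigO_logb : (fun i => Real.log (v i)) =O[l] fun i => Real.logb 2 (v i) :=
    (isBigO_const_mul_self (Real.log 2) _ l).congr_left fun i =>
      mul_div_cancel₀ _ (Real.log_pos one_lt_two).ne'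
  have logb_nonneg : ∀ᶠ i in l, 0 ≤ Real.logb 2 (u i) :=
    hu.mono fun i => Real.logb_nonneg one_lt_two
  have logb_le : ∀ᶠ i in l, Real.logb 2 (u i) ≤ Real.logb 2 (c * v i) := by
    filter_upwards [hu, hc, hv.eventually_ge_atTop 0] with i one_le u_le v_nonneg
    rw [Real.norm_of_nonneg (by linarith), Real.norm_of_nonneg v_nonneg] at u_le
    exact Real.logb_le_logb_of_le one_lt_two (by linarith) u_le
  exact (isBigO_of_nonneg_of_le logb_nonneg logb_le).trans
    (((Real.isBigO_logb_const_mul_log_atTop c).comp_tendsto hv).trans log_isBigO_logb)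

lemma tendsto_div_nhds_one_of_sub_isBigO {L ρ r g : ι → ℝ} (hL : ∀ᶠ i in l, 0 < L i)
    (hLρ : ∀ᶠ i in l, L i ≤ ρ i) (hr : (fun i => r i - ρ i) =O[l] g) (hg : g =o[l] L) :
    Tendsto (fun i => r i / ρ i) l (nhds 1) := by
  have ρ_ne : ∀ᶠ i in l, ρ i ≠ 0 := by
    filter_upwards [hL, hLρ] with i pos le using (pos.trans_le le).ne'
  have L_isBigO : L =O[l] ρ := isBigO_of_nonneg_of_le (hL.mono fun _ => le_of_lt) hLρ
  exact (isEquivalent_iff_tendsto_one ρ_ne).1 ((hr.trans_isLittleO hg).trans_isBigO L_isBigO)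

end Asymptotics

lemma tendsto_logb_logb : Tendsto (fun n : ℕ => Real.logb 2 (Real.logb 2 (n : ℝ))) atTop atTop :=
  (Real.tendsto_logb_atTop one_lt_two).comp tendsto_logb_two_natCast

lemma logb_logb_isLittleO :
    (fun n : ℕ => Real.logb 2 (Real.logb 2 (n : ℝ))) =o[atTop] fun n : ℕ => Real.logb 2 (n : ℝ) :=
  Real.isLittleO_logb_id_atTop.comp_tendsto tendsto_logb_two_natCast

section Hash

variable {k : ℕ} {m : ℕ → ℕ} {φ : ℕ → List Bool → ℕ}

lemma IsEditHash.size_isBigO (hφ : IsEditHash k m φ) :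
    (fun A : ℕ => (m A : ℝ)) =O[atTop] fun A : ℕ => Real.logb 2 (A : ℝ) := by
  obtain ⟨e, he, hm⟩ := hφ.size
  exact (isBigO_of_nonneg_of_le (.of_forall fun A => Nat.cast_nonneg _) (.of_forall hm)).trans
    ((isBigO_const_mul_self _ _ _).add he.isBigO)

lemma tendsto_delta (hk : 1 ≤ k) : Tendsto (fun n => delta k n) atTop atTop :=
  tendsto_logb_two_natCast.const_mul_atTop (by positivity)

lemma delta_sq_isBigO (k : ℕ) :
    (fun n => delta k n ^ 2) =O[atTop] fun n : ℕ => Real.logb 2 (n : ℝ) ^ 2 :=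
  (isBigO_const_mul_self _ _ _).pow 2

lemma IsEditHash.size_comp_isBigO (hk : 1 ≤ k) (hφ : IsEditHash k m φ) {A : ℕ → ℕ} {K : ℝ}
    (hK : 0 < K) (hA : ∀ n : ℕ, K * delta k n ^ 2 ≤ (A n : ℝ))
    (hA' : (fun n : ℕ => (A n : ℝ)) =O[atTop] fun n : ℕ => delta k n ^ 2) :
    (fun n => (m (A n) : ℝ)) =O[atTop] fun n : ℕ => Real.logb 2 (Real.logb 2 (n : ℝ)) := by
  have tendsto_A : Tendsto (fun n => (A n : ℝ)) atTop atTop :=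
    tendsto_atTop_mono hA
      (((tendsto_pow_atTop two_ne_zero).comp (tendsto_delta hk)).const_mul_atTop hK)
  have tendsto_sq : Tendsto (fun n : ℕ => Real.logb 2 (n : ℝ) ^ 2) atTop atTop :=
    (tendsto_pow_atTop two_ne_zero).comp tendsto_logb_two_natCast
  have logb_A_isBigO := isBigO_logb_of_isBigO (tendsto_A.eventually_ge_atTop 1) tendsto_sq
    (hA'.trans (delta_sq_isBigO k))
  simp only [Real.logb_pow] at logb_A_isBigO
  exact (hφ.size_isBigO.comp_tendsto (tendsto_natCast_atTop_iff.1 tendsto_A)).trans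
    (logb_A_isBigO.trans (isBigO_const_mul_self _ _ _))

lemma exists_code_redundancy_sub_logb_isBigO (hk : 1 ≤ k) (hφ : IsEditHash k m φ) {A : ℕ → ℕ}
    (hA : ∀ n : ℕ, windowConst k * delta k n ^ 2 ≤ (A n : ℝ))
    (hA' : (fun n : ℕ => (A n : ℝ)) =O[atTop] fun n : ℕ => delta k n ^ 2) :
    ∃ (c₁ : ℕ → ℕ × ℕ × ℕ) (c₂ : ℕ → ℕ × ℕ),
      (∀ᶠ n in atTop, (code k n (delta k n) m φ (A n) (c₁ n) (c₂ n)).Nonempty) ∧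
      (fun n : ℕ => redundancy n (code k n (delta k n) m φ (A n) (c₁ n) (c₂ n)) -
        Real.logb 2 (n : ℝ)) =O[atTop] fun n : ℕ => Real.logb 2 (Real.logb 2 (n : ℝ)) := by
  choose! c₁ c₂ nonempty redundancy_le using
    fun n (hn : 2 ≤ n) => exists_redundancy_code_le hk hn m φ (A n)
  refine ⟨c₁, c₂, (eventually_ge_atTop 2).mono nonempty, ?_⟩
  have const_isBigO : (fun _ : ℕ => Real.logb 2 (200000 * C k ^ 2 * k)) =O[atTop]
      fun n : ℕ => Real.logb 2 (Real.logb 2 (n : ℝ)) :=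
    (isLittleO_const_left.2 (.inr (tendsto_norm_atTop_atTop.comp tendsto_logb_logb))).isBigO
  refine (isBigO_of_nonneg_of_le ?_ ((eventually_ge_atTop 2).mono redundancy_le)).trans
    (const_isBigO.add ((hφ.size_comp_isBigO hk (windowConst_pos k) hA hA').const_mul_left 2))
  filter_upwards [eventually_ge_atTop 2] with n hn
  exact sub_nonneg.2 <| (logb_le_optRedundancy hk (by omega)).trans <|
    optRedundancy_le_redundancy hk (nonempty n hn) (fun x hx => hx.1)
      (corrects_code hk hφ n _ _ _ _ (hA n))

end Hash

section Optimality

variable {k : ℕ} {D : ℕ → Set (List Bool)} {g : ℕ → ℝ}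

lemma redundancy_sub_optRedundancy_isBigO (hk : 1 ≤ k) (hne : ∀ᶠ n in atTop, (D n).Nonempty)
    (hD : ∀ n, ∀ x ∈ D n, x.length = n) (hc : ∀ n, Corrects k (D n))
    (hg : (fun n : ℕ => redundancy n (D n) - Real.logb 2 (n : ℝ)) =O[atTop] g) :
    (fun n => redundancy n (D n) - optRedundancy k n) =O[atTop] g := by
  refine (isBigO_of_nonneg_of_le ?_ ?_).trans hg
  · filter_upwards [hne] with n hn
    exact sub_nonneg.2 (optRedundancy_le_redundancy hk hn (hD n) (hc n))
  · filter_upwards [eventually_ne_atTop 0] with n hn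
    exact sub_le_sub_left (logb_le_optRedundancy hk hn) _

lemma tendsto_div_optRedundancy (hk : 1 ≤ k) {r : ℕ → ℝ}
    (hr : (fun n => r n - optRedundancy k n) =O[atTop] g)
    (hg : g =o[atTop] fun n : ℕ => Real.logb 2 (n : ℝ)) :
    Tendsto (fun n => r n / optRedundancy k n) atTop (nhds 1) :=
  tendsto_div_nhds_one_of_sub_isBigO (tendsto_logb_two_natCast.eventually_gt_atTop 0)
    ((eventually_ne_atTop 0).mono fun _ hn => logb_le_optRedundancy hk hn) hr hg

end Optimality

end EditCode

theorem theorem1 (k : ℕ) (hk : 1 ≤ k) :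
    -- the hashes that enter the construction exist
    (∃ (m : ℕ → ℕ) (φ : ℕ → List Bool → ℕ), EditCode.IsEditHash k m φ) ∧
    -- the constant hidden in the block length `O(δ²)` depends on `k` only
    ∃ K₀ : ℝ, 0 < K₀ ∧
      ∀ (m : ℕ → ℕ) (φ : ℕ → List Bool → ℕ), EditCode.IsEditHash k m φ →
        -- the code corrects one `k`-substring edit
        (∀ (n : ℕ) (δ : ℝ) (A : ℕ) (c₁ : ℕ × ℕ × ℕ) (c₂ : ℕ × ℕ), K₀ * δ ^ 2 ≤ (A : ℝ) →
          EditCode.Corrects k (EditCode.code k n δ m φ A c₁ c₂)) ∧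
        -- its redundancy for `δ = k 2^{2k+3} log n` and suitable hash values
        (∀ A : ℕ → ℕ, (∀ n : ℕ, K₀ * EditCode.delta k n ^ 2 ≤ (A n : ℝ)) →
          ((fun n : ℕ => (A n : ℝ)) =O[atTop] fun n : ℕ => EditCode.delta k n ^ 2) →
          ∃ (c₁ : ℕ → ℕ × ℕ × ℕ) (c₂ : ℕ → ℕ × ℕ) (r : ℕ → ℝ),
            (∀ n : ℕ, r n = EditCode.redundancy n
              (EditCode.code k n (EditCode.delta k n) m φ (A n) (c₁ n) (c₂ n))) ∧
            ((fun n : ℕ => r n - Real.logb 2 (n : ℝ)) =O[atTop]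
              fun n : ℕ => Real.logb 2 (Real.logb 2 (n : ℝ))) ∧
            -- asymptotic optimality
            ((fun n : ℕ => r n - EditCode.optRedundancy k n) =O[atTop]
              fun n : ℕ => Real.logb 2 (Real.logb 2 (n : ℝ))) ∧
            Tendsto (fun n : ℕ => r n / EditCode.optRedundancy k n) atTop (nhds 1)) := by
  refine ⟨EditCode.exists_isEditHash hk, EditCode.windowConst k, EditCode.windowConst_pos k,
    fun m φ hφ => ⟨EditCode.corrects_code hk hφ, fun A hA hA' => ?_⟩⟩
  obtain ⟨c₁, c₂, nonempty, sub_logb_isBigO⟩ :=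
    EditCode.exists_code_redundancy_sub_logb_isBigO hk hφ hA hA'
  have sub_opt_isBigO := EditCode.redundancy_sub_optRedundancy_isBigO hk nonempty
    (fun n x hx => hx.1) (fun n => EditCode.corrects_code hk hφ n _ _ _ _ (hA n)) sub_logb_isBigO
  exact ⟨c₁, c₂, _, fun n => rfl, sub_logb_isBigO, sub_opt_isBigO,
    EditCode.tendsto_div_optRedundancy hk sub_opt_isBigO EditCode.logb_logb_isLittleO⟩
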